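/- All Banach spaces are complex. Let $U,X,Y$ be Banach spaces and let $\Sigma(A,B,C,\mathbf G)$ be an arbitrary system node on $(U,X,Y)$. That is: $A:D(A)\subset X\to X$ generates a strongly continuous semigroup $\mathbb T=(\mathbb T(t))_{t\ge 0}$ on $X$ with growth bound $\omega(\mathbb T)\in[-\infty,\infty)$; for a fixed $\mu\in\rho(A)$, $X_1$ is $D(A)$ with the norm $\|(\mu-A)x\|_X$ and $X_{-1}$ is the completion of $X$ with respect to $\|R(\mu,A)x\|_X$ (other choices of $\mu$ give equivalent norms); $A$, $\mathbb T(t)$ and $R(\beta,A)$ also denote the continuous extensions $X\to X_{-1}$, $X_{-1}\to X_{-1}$ and $X_{-1}\to X$; $B\in\mathcal L(U,X_{-1})$, $C\in\mathcal L(X_1,Y)$; and $\mathbf G:\{z\in\mathbb C:\operatorname{Re}z>\omega(\mathbb T)\}\to\mathcal L(U,Y)$ is analytic with $\mathbf G(\alpha)-\mathbf G(\beta)=C[R(\alpha,A)-R(\beta,A)]B$ for all $\alpha,\beta$ in this half-plane. Put $D(C\&D)=\{(x,u)\in X\times U: Ax+Bu\in X\}$ and $C\&D(x,u)=C[x-R(\beta,A)Bu]+\mathbf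 G(\beta)u$, which does not depend on the point $\beta$ of the half-plane. A classical solution is a triple $(u,x,y)$ with $u\in C([0,\infty),U)$, $x\in C^1([0,\infty),X)$, $y\in C([0,\infty),Y)$ such that for all $t\ge 0$: $(x(t),u(t))\in D(C\&D)$, $\dot x(t)=Ax(t)+Bu(t)$ and $y(t)=C\&D(x(t),u(t))$. A generalised distributional solution with initial value $x_0\in X$ is a triple $(u,x,y)$ where $u\in L^1_{\rm loc}([0,\infty),U)$, $x\in C([0,\infty),X_{-1})$ is given by $x(t)=\mathbb T(t)x_0+\int_0^t\mathbb T(t-s)Bu(s)\,ds$, and $y$ is the $Y$-valued distribution on $[0,\infty)$ given by $y=\frac{d^2}{dt^2}\left(C\&D\int_0^t(t-s)\begin{bmatrix}x(s)\\u(s)\end{bmatrix}ds\right)$, i.e. $\langle\varphi,y\rangle=\int_0^\infty\varphi''(t)\,C\&D\int_0^t(t-s)\begin{bmatrix}x(s)\\u(s)\end{bmatrix}ds\,dt$ for every restriction $\varphi$ to $[0,\infty)$ of a real-valued function in $C_c^\infty(\mathbb R)$. The system node is called $C^\infty$-LILO stable (respectively $L^1$-LILO stable) if there exists $c>0$ such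 that for every classical solution with $u\in C_c^\infty((0,\infty),U)$ and $x(0)=0$ (respectively every generalised distributional solution with $u\in L^1_{\rm loc}([0,\infty),U)$ and $x_0=0$) one has $y\in L^1_{\rm loc}([0,\infty),Y)$ and $$\|y\|_{L^1([0,t],Y)}\le c\,\|u\|_{L^1([0,t],U)}\qquad\text{for all }t>0.$$ Then $\Sigma(A,B,C,\mathbf G)$ is $C^\infty$-LILO stable if and only if it is $L^1$-LILO stable. -/

import Mathlib

open Set Filter Topology MeasureTheory
open scoped ContDiff Distributions LineDeriv

noncomputable section

/-! ### Strongly continuous semigroups and their generators -/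

/-- A strongly continuous semigroup `(T t)_{t ≥ 0}` of bounded operators on `X`. Only the operators
`T t` with `0 ≤ t` are meaningful. -/
structure C0Semigroup (X : Type*) [NormedAddCommGroup X] [NormedSpace ℂ X] where
  /-- The operator at time `t`. -/
  op : ℝ → X →L[ℂ] X
  op_zero : op 0 = ContinuousLinearMap.id ℂ X
  op_add : ∀ s t : ℝ, 0 ≤ s → 0 ≤ t → op (s + t) = (op s).comp (op t)
  continuousOn_orbit : ∀ x : X, ContinuousOn (fun t : ℝ => op t x) (Ici 0)

namespace C0Semigroup

variable {X : Type*} [NormedAddCommGroup X] [NormedSpace ℂ X]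

/-- The generator `A` of the semigroup: `D(A)` consists of those `x` for which
`A x = lim_{h ↓ 0} (T h x - x) / h`, the right derivative at `0` of the orbit of `x`, exists. -/
def generator (T : C0Semigroup X) : X →ₗ.[ℂ] X where
  domain :=
    { carrier := {x | ∃ z : X, HasDerivWithinAt (fun t : ℝ => T.op t x) z (Ici 0) 0}
      add_mem' := by
        rintro x y ⟨a, ha⟩ ⟨b, hb⟩
        exact ⟨a + b, by simpa using! ha.add hb⟩
      zero_mem' := ⟨0, by simpa using hasDerivWithinAt_const (0 : ℝ) (Ici 0) (0 : X)⟩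
      smul_mem' := by
        rintro c x ⟨a, ha⟩
        exact ⟨c • a, by simpa using! ha.const_smul c⟩ }
  toFun :=
    { toFun := fun x => derivWithin (fun t : ℝ => T.op t x) (Ici 0) 0
      map_add' := by
        rintro ⟨x, a, ha⟩ ⟨y, b, hb⟩
        have hu : UniqueDiffWithinAt ℝ (Ici (0 : ℝ)) 0 := uniqueDiffOn_Ici 0 0 self_mem_Ici
        have h := ha.add hb
        rw [ha.derivWithin hu, hb.derivWithin hu, ← h.derivWithin hu]
        simp [Pi.add_def]
      map_smul' := by
        rintro c ⟨x, a, ha⟩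
        have hu : UniqueDiffWithinAt ℝ (Ici (0 : ℝ)) 0 := uniqueDiffOn_Ici 0 0 self_mem_Ici
        have h := ha.const_smul c
        rw [ha.derivWithin hu, RingHom.id_apply, ← h.derivWithin hu]
        simp [Pi.smul_def] }

/-- The growth bound `ω(T)`, the infimum of all `ω` with `‖T t‖ ≤ M e^{w t}` for some `M` and all
`t ≥ 0`. It lies in `[-∞, ∞)`. -/
def growthBound (T : C0Semigroup X) : EReal :=
  ⨅ (w : ℝ) (_ : ∃ M : ℝ, ∀ t : ℝ, 0 ≤ t → ‖T.op t‖ ≤ M * Real.exp (w * t)), (w : EReal)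

/-- The open right half-plane `{z | Re z > ω(T)}`. -/
def halfPlane (T : C0Semigroup X) : Set ℂ := {z | T.growthBound < (z.re : EReal)}

end C0Semigroup

/-! ### Resolvents of unbounded operators -/

/-- `R` is the bounded two-sided inverse of `z - A : D(A) → X`. -/
def IsResolventAt {X : Type*} [NormedAddCommGroup X] [NormedSpace ℂ X]
    (A : X →ₗ.[ℂ] X) (z : ℂ) (R : X →L[ℂ] X) : Prop :=
  (∀ x : X, ∃ h : R x ∈ A.domain, z • R x - A ⟨R x, h⟩ = x) ∧
    ∀ x : A.domain, R (z • (x : X) - A x) = x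

/-- The resolvent set `ρ(A)`. -/
def unboundedResolventSet {X : Type*} [NormedAddCommGroup X] [NormedSpace ℂ X]
    (A : X →ₗ.[ℂ] X) : Set ℂ := {z | ∃ R : X →L[ℂ] X, IsResolventAt A z R}

/-- The resolvent `R(z, A) = (z - A)⁻¹` for `z ∈ ρ(A)`. -/
def unboundedResolvent {X : Type*} [NormedAddCommGroup X] [NormedSpace ℂ X]
    (A : X →ₗ.[ℂ] X) (z : unboundedResolventSet A) : X →L[ℂ] X := z.2.choose

theorem unboundedResolvent_spec {X : Type*} [NormedAddCommGroup X] [NormedSpace ℂ X]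
    (A : X →ₗ.[ℂ] X) (z : unboundedResolventSet A) :
    IsResolventAt A z (unboundedResolvent A z) := z.2.choose_spec

namespace C0Semigroup

variable {X : Type*} [NormedAddCommGroup X] [NormedSpace ℂ X]

/-- The resolvent set of the generator. -/
abbrev rho (T : C0Semigroup X) : Set ℂ := unboundedResolventSet T.generator

/-- The resolvent `R(z, A)` of the generator. -/
abbrev res (T : C0Semigroup X) (z : T.rho) : X →L[ℂ] X := unboundedResolvent T.generator z

theorem hasDerivWithinAt_of_mem (T : C0Semigroup X) (x : T.generator.domain) :
    HasDerivWithinAt (fun t : ℝ => T.op t x) (T.generator x) (Ici 0) 0 := by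
  obtain ⟨x, a, ha⟩ := x
  have hu : UniqueDiffWithinAt ℝ (Ici (0 : ℝ)) 0 := uniqueDiffOn_Ici 0 0 self_mem_Ici
  have : T.generator ⟨x, a, ha⟩ = a := ha.derivWithin hu
  rw [this]; exact ha

theorem generator_apply_of_hasDeriv (T : C0Semigroup X) {x z : X}
    (h : HasDerivWithinAt (fun t : ℝ => T.op t x) z (Ici 0) 0) :
    T.generator ⟨x, ⟨z, h⟩⟩ = z :=
  h.derivWithin (uniqueDiffOn_Ici 0 0 self_mem_Ici)

theorem op_comm (T : C0Semigroup X) {s t : ℝ} (hs : 0 ≤ s) (ht : 0 ≤ t) (x : X) :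
    T.op s (T.op t x) = T.op t (T.op s x) := by
  have h1 := T.op_add s t hs ht
  have h2 := T.op_add t s ht hs
  rw [add_comm, h1] at h2
  exact congrArg (fun L : X →L[ℂ] X => L x) h2

/-- A bounded operator commuting with the semigroup commutes with the generator. -/
theorem generator_comm (T : C0Semigroup X) (L : X →L[ℂ] X)
    (hL : ∀ t : ℝ, 0 ≤ t → ∀ x, L (T.op t x) = T.op t (L x)) (x : T.generator.domain) :
    ∃ h : L x ∈ T.generator.domain, T.generator ⟨L x, h⟩ = L (T.generator x) := by
  have h1 : HasDerivWithinAt (fun t : ℝ => L (T.op t x)) (L (T.generator x)) (Ici 0) 0 :=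
    (L.restrictScalars ℝ).hasFDerivAt.comp_hasDerivWithinAt (0 : ℝ) (T.hasDerivWithinAt_of_mem x)
  have h2 : HasDerivWithinAt (fun t : ℝ => T.op t (L x)) (L (T.generator x)) (Ici 0) 0 :=
    h1.congr (fun t ht => (hL t ht x).symm) (hL 0 le_rfl x).symm
  exact ⟨⟨_, h2⟩, T.generator_apply_of_hasDeriv h2⟩

theorem res_op_comm (T : C0Semigroup X) (z : T.rho) {t : ℝ} (ht : 0 ≤ t) (x : X) :
    T.res z (T.op t x) = T.op t (T.res z x) := by
  obtain ⟨h, hx⟩ := (unboundedResolvent_spec T.generator z).1 x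
  obtain ⟨h', hx'⟩ := T.generator_comm (T.op t) (fun s hs y => T.op_comm ht hs y) ⟨_, h⟩
  have := (unboundedResolvent_spec T.generator z).2 ⟨_, h'⟩
  rw [hx'] at this
  rw [← map_smul, ← map_sub] at this
  simp only [hx] at this
  exact this

/-- The resolvent identity. -/
theorem res_sub_res (T : C0Semigroup X) (a b : T.rho) (x : X) :
    T.res a x - T.res b x = ((b : ℂ) - a) • T.res a (T.res b x) := by
  obtain ⟨h, hx⟩ := (unboundedResolvent_spec T.generator b).1 x
  have h1 := (unboundedResolvent_spec T.generator a).2 ⟨_, h⟩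
  have h2 : T.generator ⟨_, h⟩ = (b : ℂ) • T.res b x - x := by
    rw [eq_sub_iff_add_eq, ← eq_sub_iff_add_eq']; exact hx.symm
  rw [h2] at h1
  simp only [map_sub, map_smul] at h1
  rw [sub_eq_iff_eq_add]
  refine Eq.trans ?_ (congrArg (fun w => ((b : ℂ) - a) • T.res a (T.res b x) + w) h1)
  module

theorem res_injective (T : C0Semigroup X) (z : T.rho) : Function.Injective (T.res z) := by
  intro x y hxy
  obtain ⟨h, hx⟩ := (unboundedResolvent_spec T.generator z).1 x
  obtain ⟨h', hy⟩ := (unboundedResolvent_spec T.generator z).1 y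
  rw [← hx, ← hy]
  have : (⟨_, h⟩ : T.generator.domain) = ⟨_, h'⟩ := Subtype.ext hxy
  rw [this]
  congr 2

/-! ### The domain of the generator is dense -/

theorem intervalIntegrable_orbit (T : C0Semigroup X) (x : X) {a b : ℝ}
    (ha : 0 ≤ a) (hb : 0 ≤ b) : IntervalIntegrable (fun s => T.op s x) volume a b :=
  ((T.continuousOn_orbit x).mono (fun _ hs => (le_min ha hb).trans hs.1)).intervalIntegrable

theorem hasDerivWithinAt_primitive [CompleteSpace X] {f : ℝ → X} (hf : ContinuousOn f (Ici 0))
    {t : ℝ} (ht : 0 ≤ t) :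
    HasDerivWithinAt (fun r => ∫ s in (0 : ℝ)..r, f s) (f t) (Ici t) t := by
  refine intervalIntegral.integral_hasDerivWithinAt_right (s := Ici t) (t := Ioi t)
    ((hf.mono (fun _ hs => (le_min le_rfl ht).trans hs.1)).intervalIntegrable) ?_ ?_
  · exact ((hf.mono (fun s hs => ht.trans (le_of_lt hs))).stronglyMeasurableAtFilter_nhdsWithin
      measurableSet_Ioi t)
  · exact (hf t ht).mono (fun s hs => ht.trans (le_of_lt hs))

theorem dense_domain [CompleteSpace X] (T : C0Semigroup X) :
    DenseRange T.generator.domain.subtype := by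
  have hr : Set.range T.generator.domain.subtype = (T.generator.domain : Set X) := by
    ext; simp
  rw [DenseRange, hr]
  intro x
  set F : ℝ → X := fun r => ∫ s in (0 : ℝ)..r, T.op s x with hF
  have hFd : ∀ t, 0 ≤ t → HasDerivWithinAt F (T.op t x) (Ici t) t := fun t ht =>
    hasDerivWithinAt_primitive (T.continuousOn_orbit x) ht
  have hmem : ∀ h, 0 ≤ h → F h ∈ T.generator.domain := by
    intro h hh
    refine ⟨T.op h x - T.op 0 x, ?_⟩
    have key : ∀ t, 0 ≤ t → T.op t (F h) = F (h + t) - F t := by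
      intro t ht
      have h1 : T.op t (F h) = ∫ s in (0 : ℝ)..h, T.op t (T.op s x) :=
        ((T.op t).intervalIntegral_comp_comm (T.intervalIntegrable_orbit x le_rfl hh)).symm
      have h2 : (∫ s in (0 : ℝ)..h, T.op t (T.op s x)) = ∫ s in (0 : ℝ)..h, T.op (s + t) x := by
        refine intervalIntegral.integral_congr (fun s hs => ?_)
        rw [uIcc_of_le hh] at hs
        simp only [add_comm s t, T.op_add t s ht hs.1, ContinuousLinearMap.comp_apply]
      rw [h1, h2, intervalIntegral.integral_comp_add_right (fun s => T.op s x), zero_add]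
      exact (intervalIntegral.integral_interval_sub_left
        (T.intervalIntegrable_orbit x le_rfl (by positivity))
        (T.intervalIntegrable_orbit x le_rfl ht)).symm
    have h3 : HasDerivWithinAt (fun t => F (h + t)) (T.op h x) (Ici 0) 0 := by
      have hg : HasDerivWithinAt F (T.op h x) (Ici h) (h + 0) := by simpa using hFd h hh
      have hk : HasDerivWithinAt (fun t : ℝ => h + t) 1 (Ici 0) 0 :=
        ((hasDerivAt_id (0 : ℝ)).const_add h).hasDerivWithinAt
      simpa using! hg.scomp (0 : ℝ) hk (fun t ht => by simpa using ht)
    exact (h3.sub (hFd 0 le_rfl)).congr (fun t ht => key t ht) (key 0 le_rfl)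
  have hlim : Tendsto (fun h : ℝ => h⁻¹ • F h) (𝓝[>] 0) (𝓝 x) := by
    have h := (hFd 0 le_rfl).mono Ioi_subset_Ici_self
    rw [hasDerivWithinAt_iff_tendsto_slope' (by simp)] at h
    have h0 : F 0 = 0 := by simp [hF]
    simpa [slope_fun_def, h0, T.op_zero] using! h
  refine mem_closure_of_tendsto hlim ?_
  filter_upwards [self_mem_nhdsWithin] with h hh
  have hc := T.generator.domain.smul_mem ((h⁻¹ : ℝ) : ℂ) (hmem h (le_of_lt hh))
  rwa [Complex.coe_smul] at hc

/-! ### Exponential bounds, and the half-plane lies in the resolvent set -/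

theorem exists_exponential_bound [CompleteSpace X] (T : C0Semigroup X) :
    ∃ w M : ℝ, ∀ t : ℝ, 0 ≤ t → ‖T.op t‖ ≤ M * Real.exp (w * t) := by
  obtain ⟨C, hC⟩ : ∃ C, ∀ t : Icc (0 : ℝ) 1, ‖T.op t‖ ≤ C := by
    refine banach_steinhaus (fun x => ?_)
    obtain ⟨C, hC⟩ := isCompact_Icc.exists_bound_of_continuousOn
      ((T.continuousOn_orbit x).mono (Icc_subset_Ici_self : Icc (0 : ℝ) 1 ⊆ Ici 0))
    exact ⟨C, fun t => hC t t.2⟩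
  set M := max C 1 with hM
  have hM1 : 1 ≤ M := le_max_right _ _
  have hM0 : 0 < M := by linarith
  have step : ∀ n : ℕ, ∀ t : ℝ, (n : ℝ) ≤ t → t ≤ n + 1 → ‖T.op t‖ ≤ M ^ (n + 1) := by
    intro n
    induction n with
    | zero =>
      intro t h0 h1
      have := hC ⟨t, by simpa using h0, by simpa using h1⟩
      rw [zero_add, pow_one]
      exact this.trans (le_max_left _ _)
    | succ n ih =>
      intro t h0 h1
      push_cast at h0 h1
      have hn : (0 : ℝ) ≤ n := Nat.cast_nonneg n
      have e : T.op t = (T.op 1).comp (T.op (t - 1)) := by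
        rw [← T.op_add 1 (t - 1) zero_le_one (by linarith)]; congr 1; ring
      rw [e, pow_succ']
      refine (ContinuousLinearMap.opNorm_comp_le _ _).trans ?_
      refine mul_le_mul ?_ (ih _ (by linarith) (by linarith)) (norm_nonneg _) hM0.le
      exact (hC ⟨1, by simp⟩).trans (le_max_left _ _)
  refine ⟨Real.log M, M, fun t ht => ?_⟩
  refine (step ⌊t⌋₊ t (Nat.floor_le ht) (Nat.lt_floor_add_one t).le).trans ?_
  rw [pow_succ']
  refine mul_le_mul_of_nonneg_left ?_ hM0.le
  rw [← Real.rpow_def_of_pos hM0, ← Real.rpow_natCast]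
  exact Real.rpow_le_rpow_of_exponent_le hM1 (Nat.floor_le ht)

theorem halfPlane_nonempty [CompleteSpace X] (T : C0Semigroup X) : T.halfPlane.Nonempty := by
  obtain ⟨w, M, h⟩ := T.exists_exponential_bound
  refine ⟨((w + 1 : ℝ) : ℂ), ?_⟩
  have h1 : T.growthBound ≤ (w : EReal) := iInf₂_le w ⟨M, h⟩
  refine lt_of_le_of_lt h1 ?_
  simp only [Complex.ofReal_re]
  exact_mod_cast lt_add_one w

theorem halfPlane_subset_rho [CompleteSpace X] (T : C0Semigroup X) : T.halfPlane ⊆ T.rho := by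
  intro z hz
  obtain ⟨w, hω⟩ := iInf_lt_iff.1 (show T.growthBound < (z.re : EReal) from hz)
  obtain ⟨⟨M, hM⟩, hω⟩ := iInf_lt_iff.1 hω
  have hω : w < z.re := by exact_mod_cast hω
  set f : X → ℝ → X := fun x t => Complex.exp (-(z * t)) • T.op t x with hf
  have hfc : ∀ x, ContinuousOn (f x) (Ici 0) := fun x =>
    (by fun_prop : Continuous fun t : ℝ => Complex.exp (-(z * t))).continuousOn.smul
      (T.continuousOn_orbit x)
  have hfb : ∀ x, ∀ t ∈ Ioi (0 : ℝ), ‖f x t‖ ≤ M * ‖x‖ * Real.exp (-(z.re - w) * t) := by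
    intro x t ht
    have h1 : ‖T.op t x‖ ≤ M * Real.exp (w * t) * ‖x‖ :=
      (T.op t).le_of_opNorm_le (hM t (le_of_lt ht)) x
    rw [hf, norm_smul, Complex.norm_exp]
    have h2 : (-(z * (t : ℂ))).re = -(z.re * t) := by simp
    rw [h2]
    refine (mul_le_mul_of_nonneg_left h1 (Real.exp_nonneg _)).trans (le_of_eq ?_)
    have h3 : Real.exp (-(z.re - w) * t) = Real.exp (-(z.re * t)) * Real.exp (w * t) := by
      rw [← Real.exp_add]; congr 1; ring
    rw [h3]; ring
  have hgi : ∀ x : X, IntegrableOn (fun t => M * ‖x‖ * Real.exp (-(z.re - w) * t)) (Ioi (0 : ℝ)) :=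
    fun x => (integrableOn_exp_mul_Ioi (by linarith) 0).const_mul _
  have hfi : ∀ x, IntegrableOn (f x) (Ioi 0) := by
    intro x
    refine Integrable.mono' (hgi x)
      (((hfc x).mono Ioi_subset_Ici_self).aestronglyMeasurable measurableSet_Ioi) ?_
    exact (ae_restrict_mem measurableSet_Ioi).mono (fun t ht => hfb x t ht)
  let R0 : X →ₗ[ℂ] X :=
    { toFun := fun x => ∫ t in Ioi (0 : ℝ), f x t
      map_add' := by
        intro x y
        rw [← integral_add (hfi x) (hfi y)]
        simp [hf]
      map_smul' := by
        intro c x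
        rw [RingHom.id_apply, ← integral_smul]
        simp [hf, smul_comm c] }
  have hR0 : ∀ x, ‖R0 x‖ ≤ (M * ∫ t in Ioi (0 : ℝ), Real.exp (-(z.re - w) * t)) * ‖x‖ := by
    intro x
    refine (norm_integral_le_of_norm_le (hgi x)
      ((ae_restrict_mem measurableSet_Ioi).mono (fun t ht => hfb x t ht))).trans (le_of_eq ?_)
    rw [integral_const_mul]; ring
  let R : X →L[ℂ] X := R0.mkContinuous _ hR0
  have hR : ∀ x, R x = ∫ t in Ioi (0 : ℝ), f x t := fun x => rfl
  have hcomm : ∀ t : ℝ, 0 ≤ t → ∀ x, R (T.op t x) = T.op t (R x) := by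
    intro t ht x
    rw [hR, hR, ← ContinuousLinearMap.integral_comp_comm _ (hfi x)]
    refine setIntegral_congr_fun measurableSet_Ioi (fun s hs => ?_)
    simp only [hf, map_smul]
    rw [T.op_comm ht (le_of_lt hs)]
  have hder : ∀ x, HasDerivWithinAt (fun t : ℝ => T.op t (R x)) (z • R x - x) (Ici 0) 0 := by
    intro x
    have key : ∀ h : ℝ, 0 ≤ h → T.op h (R x) =
        Complex.exp (z * h) • (R x - ∫ s in (0 : ℝ)..h, f x s) := by
      intro h hh
      have e1 : R x - ∫ s in (0 : ℝ)..h, f x s = ∫ s in Ioi h, f x s := by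
        rw [hR, ← intervalIntegral.integral_interval_add_Ioi (a := (0 : ℝ)) (b := h) (hfi x)
          ((hfi x).mono_set (Ioi_subset_Ioi hh))]
        abel
      have e2 : ∫ s in Ioi h, f x s = ∫ s in Ioi (0 : ℝ), f x (s + h) := by
        have h1 := (measurePreserving_add_right volume h).setIntegral_preimage_emb
          (measurableEmbedding_addRight h) (f x) (Ioi h)
        rw [← h1]; simp
      rw [e1, e2, hR, ← ContinuousLinearMap.integral_comp_comm _ (hfi x), ← integral_smul]
      refine setIntegral_congr_fun measurableSet_Ioi (fun s hs => ?_)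
      simp only [hf, map_smul, smul_smul, ← Complex.exp_add]
      rw [add_comm s h, T.op_add h s hh (le_of_lt hs)]
      congr 2
      push_cast; ring
    have d1 : HasDerivWithinAt (fun h : ℝ => Complex.exp (z * h)) z (Ici 0) 0 := by
      have : HasDerivAt (fun h : ℝ => Complex.exp (z * h)) (Complex.exp (z * (0 : ℝ)) * (z * 1)) 0 :=
        ((Complex.ofRealCLM.hasDerivAt (x := (0 : ℝ))).const_mul z).cexp
      simpa using this.hasDerivWithinAt
    have d2 := (hasDerivWithinAt_primitive (hfc x) le_rfl).const_sub (R x)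
    have d3 := d1.smul d2
    have d4 : HasDerivWithinAt (fun t : ℝ => T.op t (R x))
        (Complex.exp (z * (0 : ℝ)) • -(f x 0) +
          z • (R x - ∫ s in (0 : ℝ)..0, f x s)) (Ici 0) 0 :=
      d3.congr (fun t ht => key t ht) (key 0 le_rfl)
    have e : Complex.exp (z * (0 : ℝ)) • -(f x 0) + z • (R x - ∫ s in (0 : ℝ)..0, f x s)
        = z • R x - x := by
      simp [hf, T.op_zero]; abel
    rwa [e] at d4
  refine ⟨R, fun x => ⟨⟨_, hder x⟩, ?_⟩, fun x => ?_⟩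
  · rw [T.generator_apply_of_hasDeriv (hder x)]; abel
  · obtain ⟨h, hx⟩ := T.generator_comm R hcomm x
    rw [map_sub, map_smul, ← hx, T.generator_apply_of_hasDeriv (hder x)]; abel

/-- A point of the half-plane, regarded as an element of the resolvent set. -/
def toRho [CompleteSpace X] (T : C0Semigroup X) (z : T.halfPlane) : T.rho :=
  ⟨z, T.halfPlane_subset_rho z.2⟩

/-! ### The interpolation space `X₁` and the extrapolation space `X₋₁` -/

/-- The space `X₁`: the domain `D(A)` with the norm `‖x‖₁ = ‖(μ - A) x‖`, where `μ ∈ ρ(A)`. -/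
def X1 (T : C0Semigroup X) (_μ : T.rho) : Type _ := T.generator.domain

/-- The linear map `μ - A : X₁ → X`. -/
def X1.shift (T : C0Semigroup X) (μ : T.rho) : T.generator.domain →ₗ[ℂ] X :=
  (μ : ℂ) • T.generator.domain.subtype - T.generator.toFun

theorem X1.shift_injective (T : C0Semigroup X) (μ : T.rho) :
    Function.Injective (X1.shift T μ) := by
  intro x y hxy
  have hx := (unboundedResolvent_spec T.generator μ).2 x
  have hy := (unboundedResolvent_spec T.generator μ).2 y
  exact Subtype.ext (by rw [← hx, ← hy]; exact congrArg _ hxy)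

instance (T : C0Semigroup X) (μ : T.rho) : AddCommGroup (T.X1 μ) :=
  inferInstanceAs (AddCommGroup T.generator.domain)

instance (T : C0Semigroup X) (μ : T.rho) : Module ℂ (T.X1 μ) :=
  inferInstanceAs (Module ℂ T.generator.domain)

instance (T : C0Semigroup X) (μ : T.rho) : NormedAddCommGroup (T.X1 μ) :=
  NormedAddCommGroup.induced (T.X1 μ) X (X1.shift T μ) (X1.shift_injective T μ)

instance (T : C0Semigroup X) (μ : T.rho) : NormedSpace ℂ (T.X1 μ) :=
  NormedSpace.induced ℂ (T.X1 μ) X (X1.shift T μ)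

/-- An element of `D(A)`, regarded as an element of `X₁`. -/
def toX1 (T : C0Semigroup X) (μ : T.rho) : T.generator.domain →ₗ[ℂ] T.X1 μ := LinearMap.id

theorem norm_toX1 (T : C0Semigroup X) (μ : T.rho) (x : T.generator.domain) :
    ‖T.toX1 μ x‖ = ‖(μ : ℂ) • (x : X) - T.generator x‖ := rfl

/-- The vector space `X` with the norm `‖x‖₋₁ = ‖R(μ, A) x‖`, where `μ ∈ ρ(A)`. -/
def PreXneg (_T : C0Semigroup X) (_μ : _T.rho) : Type _ := X

instance (T : C0Semigroup X) (μ : T.rho) : AddCommGroup (T.PreXneg μ) :=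
  inferInstanceAs (AddCommGroup X)

instance (T : C0Semigroup X) (μ : T.rho) : Module ℂ (T.PreXneg μ) :=
  inferInstanceAs (Module ℂ X)

instance (T : C0Semigroup X) (μ : T.rho) : NormedAddCommGroup (T.PreXneg μ) :=
  NormedAddCommGroup.induced (T.PreXneg μ) X (T.res μ).toLinearMap (T.res_injective μ)

instance (T : C0Semigroup X) (μ : T.rho) : NormedSpace ℂ (T.PreXneg μ) :=
  NormedSpace.induced ℂ (T.PreXneg μ) X (T.res μ).toLinearMap

/-- The extrapolation space `X₋₁`: the completion of `X` for the norm `‖x‖₋₁ = ‖R(μ, A) x‖`. -/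
def Xneg (T : C0Semigroup X) (μ : T.rho) : Type _ := UniformSpace.Completion (T.PreXneg μ)

instance (T : C0Semigroup X) (μ : T.rho) : NormedAddCommGroup (T.Xneg μ) :=
  inferInstanceAs (NormedAddCommGroup (UniformSpace.Completion (T.PreXneg μ)))

instance (T : C0Semigroup X) (μ : T.rho) : NormedSpace ℂ (T.Xneg μ) :=
  inferInstanceAs (NormedSpace ℂ (UniformSpace.Completion (T.PreXneg μ)))

instance (T : C0Semigroup X) (μ : T.rho) : CompleteSpace (T.Xneg μ) :=
  inferInstanceAs (CompleteSpace (UniformSpace.Completion (T.PreXneg μ)))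

/-- The canonical embedding `X → X₋₁`, as a linear map. -/
def embₗ (T : C0Semigroup X) (μ : T.rho) : X →ₗ[ℂ] T.Xneg μ :=
  (UniformSpace.Completion.toComplₗᵢ (𝕜 := ℂ) (E := T.PreXneg μ)).toLinearMap

theorem norm_embₗ (T : C0Semigroup X) (μ : T.rho) (x : X) : ‖T.embₗ μ x‖ = ‖T.res μ x‖ :=
  UniformSpace.Completion.norm_coe (show T.PreXneg μ from x)

/-- The canonical embedding `X → X₋₁`. -/
def emb (T : C0Semigroup X) (μ : T.rho) : X →L[ℂ] T.Xneg μ :=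
  (T.embₗ μ).mkContinuous ‖T.res μ‖ (fun x => by
    rw [norm_embₗ]; exact (T.res μ).le_opNorm x)

theorem norm_emb (T : C0Semigroup X) (μ : T.rho) (x : X) : ‖T.emb μ x‖ = ‖T.res μ x‖ :=
  T.norm_embₗ μ x

theorem denseRange_emb (T : C0Semigroup X) (μ : T.rho) : DenseRange (T.emb μ).toLinearMap :=
  UniformSpace.Completion.denseRange_coe (α := T.PreXneg μ)

theorem emb_injective (T : C0Semigroup X) (μ : T.rho) : Function.Injective (T.emb μ) :=
  UniformSpace.Completion.coe_injective (T.PreXneg μ)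

/-! ### Extensions of the semigroup, the resolvent and the generator

`f.extendOfNorm e` is the extension by continuity of the linear map `f` along the linear map `e`
of dense range; the lemmas below record that it exists in each case. -/

/-- The extension `T₋₁ t : X₋₁ → X₋₁` of the operator `T t`. -/
def opNeg (T : C0Semigroup X) (μ : T.rho) (t : ℝ) : T.Xneg μ →L[ℂ] T.Xneg μ :=
  ((T.emb μ).toLinearMap ∘ₗ (T.op t).toLinearMap).extendOfNorm (T.emb μ).toLinearMap

theorem opNeg_emb (T : C0Semigroup X) (μ : T.rho) {t : ℝ} (ht : 0 ≤ t) (x : X) :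
    T.opNeg μ t (T.emb μ x) = T.emb μ (T.op t x) := by
  refine LinearMap.extendOfNorm_eq (T.denseRange_emb μ) ⟨‖T.op t‖, fun x => ?_⟩ x
  simp only [LinearMap.comp_apply, ContinuousLinearMap.coe_coe, norm_emb, T.res_op_comm μ ht]
  exact (T.op t).le_opNorm _

/-- The extension `R(z, A₋₁) : X₋₁ → X` of the resolvent `R(z, A)`. -/
def resNeg [CompleteSpace X] (T : C0Semigroup X) (μ z : T.rho) : T.Xneg μ →L[ℂ] X :=
  (T.res z).toLinearMap.extendOfNorm (T.emb μ).toLinearMap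

theorem resNeg_emb [CompleteSpace X] (T : C0Semigroup X) (μ z : T.rho) (x : X) :
    T.resNeg μ z (T.emb μ x) = T.res z x := by
  refine LinearMap.extendOfNorm_eq (T.denseRange_emb μ)
    ⟨1 + ‖((μ : ℂ) - z) • T.res z‖, fun x => ?_⟩ x
  simp only [ContinuousLinearMap.coe_coe, norm_emb]
  have h : T.res z x = T.res μ x + (((μ : ℂ) - z) • T.res z) (T.res μ x) := by
    have := T.res_sub_res z μ x
    simp only [smul_apply]
    rw [← this]; abel
  rw [h, add_mul, one_mul]
  exact (norm_add_le _ _).trans (add_le_add le_rfl (ContinuousLinearMap.le_opNorm _ _))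

/-- The extension `A₋₁ : X → X₋₁` of the generator. -/
def genNeg (T : C0Semigroup X) (μ : T.rho) : X →L[ℂ] T.Xneg μ :=
  ((T.emb μ).toLinearMap ∘ₗ T.generator.toFun).extendOfNorm T.generator.domain.subtype

theorem genNeg_coe [CompleteSpace X] (T : C0Semigroup X) (μ : T.rho) (x : T.generator.domain) :
    T.genNeg μ x = T.emb μ (T.generator x) := by
  refine LinearMap.extendOfNorm_eq T.dense_domain ⟨‖(μ : ℂ) • T.res μ‖ + 1, fun x => ?_⟩ x
  simp only [LinearMap.comp_apply, ContinuousLinearMap.coe_coe, norm_emb, Submodule.subtype_apply]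
  have h : T.res μ (T.generator x) = ((μ : ℂ) • T.res μ) x - (x : X) := by
    have := (unboundedResolvent_spec T.generator μ).2 x
    rw [map_sub, map_smul] at this
    rw [smul_apply, eq_sub_iff_add_eq, ← eq_sub_iff_add_eq']
    exact this.symm
  change ‖T.res μ (T.generator x)‖ ≤ _
  rw [h, add_mul, one_mul]
  exact (norm_sub_le _ _).trans (add_le_add (ContinuousLinearMap.le_opNorm _ _) le_rfl)

theorem resNeg_genNeg [CompleteSpace X] (T : C0Semigroup X) (μ z : T.rho) (x : X) :
    T.resNeg μ z (T.genNeg μ x) = (z : ℂ) • T.res z x - x := by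
  refine T.dense_domain.induction_on (p := fun x => T.resNeg μ z (T.genNeg μ x) =
    (z : ℂ) • T.res z x - x) x (isClosed_eq (by fun_prop) (by fun_prop)) (fun x => ?_)
  rw [Submodule.subtype_apply, genNeg_coe, resNeg_emb]
  have := (unboundedResolvent_spec T.generator z).2 x
  rw [map_sub, map_smul] at this
  rw [eq_sub_iff_add_eq, ← eq_sub_iff_add_eq']
  exact this.symm

theorem res_mem (T : C0Semigroup X) (z : T.rho) (x : X) : T.res z x ∈ T.generator.domain :=
  ((unboundedResolvent_spec T.generator z).1 x).1

/-- The operator `R(a, A₋₁) - R(b, A₋₁)` maps `X₋₁` into `D(A)`. -/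
theorem resNeg_sub_mem [CompleteSpace X] (T : C0Semigroup X) (μ a b : T.rho) (v : T.Xneg μ) :
    T.resNeg μ a v - T.resNeg μ b v ∈ T.generator.domain := by
  have h : T.resNeg μ a v - T.resNeg μ b v = ((b : ℂ) - a) • T.res a (T.resNeg μ b v) := by
    refine (T.denseRange_emb μ).induction_on (p := fun v => T.resNeg μ a v - T.resNeg μ b v =
      ((b : ℂ) - a) • T.res a (T.resNeg μ b v)) v (isClosed_eq (by fun_prop) (by fun_prop))
      (fun x => ?_)
    simp only [ContinuousLinearMap.coe_coe, resNeg_emb]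
    exact T.res_sub_res a b x
  rw [h]
  exact T.generator.domain.smul_mem _ (T.res_mem a _)

/-- If `A₋₁ x + v ∈ X` then `x - R(z, A₋₁) v ∈ D(A)`. -/
theorem sub_resNeg_mem [CompleteSpace X] (T : C0Semigroup X) (μ z : T.rho) {x : X} {v : T.Xneg μ}
    (h : T.genNeg μ x + v ∈ LinearMap.range (T.emb μ).toLinearMap) :
    x - T.resNeg μ z v ∈ T.generator.domain := by
  obtain ⟨w, hw⟩ := h
  have hv : v = T.emb μ w - T.genNeg μ x := by
    rw [eq_sub_iff_add_eq, add_comm]; exact hw.symm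
  have e : x - T.resNeg μ z v = T.res z ((z : ℂ) • x - w) := by
    rw [hv, map_sub, resNeg_emb, resNeg_genNeg, map_sub, map_smul]; abel
  rw [e]
  exact T.res_mem z _

end C0Semigroup

/-! ### System nodes -/

/-- A system node `Σ(A, B, C, G)` on `(U, X, Y)`: the generator `A` of a strongly continuous
semigroup on `X`, bounded operators `B : U → X₋₁` and `C : X₁ → Y`, and an analytic function
`G : {Re z > ω(T)} → L(U, Y)` with `G(a) - G(b) = C (R(a, A) - R(b, A)) B`. The point `μ ∈ ρ(A)`
is the one used for the norms of `X₁` and `X₋₁`; other points give equivalent norms. -/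
structure SystemNode (U X Y : Type*)
    [NormedAddCommGroup U] [NormedSpace ℂ U]
    [NormedAddCommGroup X] [NormedSpace ℂ X] [CompleteSpace X]
    [NormedAddCommGroup Y] [NormedSpace ℂ Y] where
  /-- The semigroup, whose generator is `A`. -/
  T : C0Semigroup X
  /-- The reference point in the resolvent set. -/
  μ : T.rho
  /-- The input operator. -/
  B : U →L[ℂ] T.Xneg μ
  /-- The output operator. -/
  C : T.X1 μ →L[ℂ] Y
  /-- The transfer function; only its values on the half-plane are meaningful. -/
  G : ℂ → U →L[ℂ] Y
  analytic_G : AnalyticOnNhd ℂ G T.halfPlane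
  G_sub_G : ∀ (a b : T.halfPlane) (u : U),
    G a u - G b u =
      C (T.toX1 μ ⟨T.resNeg μ (T.toRho a) (B u) - T.resNeg μ (T.toRho b) (B u),
        T.resNeg_sub_mem μ _ _ (B u)⟩)

namespace SystemNode

variable {U X Y : Type*}
  [NormedAddCommGroup U] [NormedSpace ℂ U]
  [NormedAddCommGroup X] [NormedSpace ℂ X] [CompleteSpace X]
  [NormedAddCommGroup Y] [NormedSpace ℂ Y]

/-- The domain `D(C&D) = {(x, u) | A₋₁ x + B u ∈ X}`. -/
def domainCD (S : SystemNode U X Y) : Submodule ℂ (X × U) :=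
  (LinearMap.range (S.T.emb S.μ).toLinearMap).comap ((S.T.genNeg S.μ).coprod S.B).toLinearMap

/-- For `z` in the half-plane, the operator `(x, u) ↦ C (x - R(z, A) B u) + G(z) u` with domain
`D(C&D)`. -/
def combinedAt (S : SystemNode U X Y) (z : S.T.halfPlane) : (X × U) →ₗ.[ℂ] Y where
  domain := S.domainCD
  toFun :=
    (S.C.toLinearMap ∘ₗ S.T.toX1 S.μ) ∘ₗ
      LinearMap.codRestrict S.T.generator.domain
        ((LinearMap.fst ℂ X U - (S.T.resNeg S.μ (S.T.toRho z)).toLinearMap ∘ₗ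
          S.B.toLinearMap ∘ₗ LinearMap.snd ℂ X U) ∘ₗ S.domainCD.subtype)
        (fun p => S.T.sub_resNeg_mem S.μ (S.T.toRho z) p.2) +
    (S.G z).toLinearMap ∘ₗ LinearMap.snd ℂ X U ∘ₗ S.domainCD.subtype

theorem combinedAt_apply (S : SystemNode U X Y) (z : S.T.halfPlane) (p : S.domainCD) :
    S.combinedAt z p =
      S.C (S.T.toX1 S.μ ⟨p.1.1 - S.T.resNeg S.μ (S.T.toRho z) (S.B p.1.2),
        S.T.sub_resNeg_mem S.μ _ p.2⟩) + S.G z p.1.2 := rfl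

/-- The operator `combinedAt z` does not depend on the point `z`. -/
theorem combinedAt_eq (S : SystemNode U X Y) (z w : S.T.halfPlane) :
    S.combinedAt z = S.combinedAt w := by
  refine LinearPMap.ext rfl (fun p hp hq => ?_)
  have h := S.G_sub_G w z p.2
  refine (S.combinedAt_apply z ⟨p, hp⟩).trans (Eq.trans ?_ (S.combinedAt_apply w ⟨p, hq⟩).symm)
  rw [← sub_eq_iff_eq_add, add_sub_assoc, ← neg_sub (S.G w p.2), h, ← sub_eq_add_neg,
    sub_eq_iff_eq_add', ← map_add, ← map_add]
  congr 2
  refine Subtype.ext ?_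
  exact (sub_add_sub_cancel' _ _ _).symm

/-- The combined observation/feedthrough operator `C&D`, defined through some point of the
half-plane. -/
def CD (S : SystemNode U X Y) : (X × U) →ₗ.[ℂ] Y :=
  S.combinedAt ⟨S.T.halfPlane_nonempty.choose, S.T.halfPlane_nonempty.choose_spec⟩

/-! ### Solutions -/

/-- Classical solutions `(u, x, y)`: `u`, `y` continuous and `x` continuously differentiable on
`[0, ∞)`, and for all `t ≥ 0`, `(x t, u t) ∈ D(C&D)`, `x' t = A x t + B u t` (in `X₋₁`) and
`y t = C&D (x t, u t)`. Only the values on `[0, ∞)` matter. -/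
def IsClassicalSolution (S : SystemNode U X Y) (u : ℝ → U) (x : ℝ → X) (y : ℝ → Y) : Prop :=
  ContinuousOn u (Ici 0) ∧ ContDiffOn ℝ 1 x (Ici 0) ∧ ContinuousOn y (Ici 0) ∧
    ∀ t : ℝ, 0 ≤ t → ∃ h : (x t, u t) ∈ S.CD.domain,
      S.T.emb S.μ (derivWithin x (Ici 0) t) = S.T.genNeg S.μ (x t) + S.B (u t) ∧
      y t = S.CD ⟨(x t, u t), h⟩

/-- The `Y`-valued distribution on `[0, ∞)` given by a function `g` on `[0, ∞)`, as a distribution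
on `ℝ`: it maps the test function `φ` to `∫_{[0, ∞)} φ t • g t dt`. -/
def distOf (g : ℝ → Y) : 𝓓'((⊤ : TopologicalSpace.Opens ℝ), Y) where
  toFun := TestFunction.integralAgainstBilinCLM (ContinuousLinearMap.lsmul ℝ ℝ : ℝ →L[ℝ] Y →L[ℝ] Y)
    (volume.restrict (Ici 0)) g
  map_add' := map_add _
  map_smul' := map_smul _
  cont := ContinuousLinearMap.continuous _

theorem distOf_apply (g : ℝ → Y) (hg : LocallyIntegrableOn g (Ici 0))
    (φ : 𝓓((⊤ : TopologicalSpace.Opens ℝ), ℝ)) :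
    distOf g φ = ∫ t in Ici (0 : ℝ), φ t • g t := by
  have h : LocallyIntegrableOn g ((⊤ : TopologicalSpace.Opens ℝ) : Set ℝ)
      (volume.restrict (Ici 0)) := by
    rw [TopologicalSpace.Opens.coe_top, locallyIntegrableOn_univ]
    exact (locallyIntegrableOn_iff_locallyIntegrable_restrict isClosed_Ici).1 hg
  exact TestFunction.integralAgainstBilinCLM_eq_integral h

/-- Generalised solutions in the distributional sense with initial value `x₀ ∈ X`: `u` is locally
integrable on `[0, ∞)`, `x` is the `X₋₁`-valued continuous function
`x t = T t x₀ + ∫_0^t T₋₁ (t - s) B u(s) ds`, and `y` is the second distributional derivative of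
`f t = C&D ∫_0^t (t - s) (x s, u s) ds`. -/
def IsGeneralisedSolution (S : SystemNode U X Y) (x₀ : X) (u : ℝ → U) (x : ℝ → S.T.Xneg S.μ)
    (y : 𝓓'((⊤ : TopologicalSpace.Opens ℝ), Y)) : Prop :=
  LocallyIntegrableOn u (Ici 0) ∧ ContinuousOn x (Ici 0) ∧
    (∀ t : ℝ, 0 ≤ t → x t = S.T.emb S.μ (S.T.op t x₀) +
      ∫ s in (0 : ℝ)..t, S.T.opNeg S.μ (t - s) (S.B (u s))) ∧
    ∃ f : ℝ → Y,
      (∀ t : ℝ, 0 ≤ t → ∃ p : S.CD.domain,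
        S.T.emb S.μ p.1.1 = (∫ s in (0 : ℝ)..t, (t - s) • x s) ∧
        p.1.2 = (∫ s in (0 : ℝ)..t, (t - s) • u s) ∧
        f t = S.CD p) ∧
      y = ∂_{(1 : ℝ)} (∂_{(1 : ℝ)} (distOf f))

/-! ### LILO stability -/

/-- `C^∞`-LILO stability: a uniform `L¹`-estimate of the output by the input for the classical
solutions with `u ∈ C_c^∞((0, ∞), U)` and `x 0 = 0`. -/
def IsSmoothLILOStable (S : SystemNode U X Y) : Prop :=
  ∃ c : ℝ, 0 < c ∧ ∀ (u : ℝ → U) (x : ℝ → X) (y : ℝ → Y),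
    S.IsClassicalSolution u x y →
    ContDiff ℝ ∞ u → HasCompactSupport u → tsupport u ⊆ Ioi 0 → x 0 = 0 →
    LocallyIntegrableOn y (Ici 0) ∧
      ∀ t : ℝ, 0 < t → (∫ s in (0 : ℝ)..t, ‖y s‖) ≤ c * ∫ s in (0 : ℝ)..t, ‖u s‖

/-- `L¹`-LILO stability: for every generalised solution with `u ∈ L¹_loc([0, ∞), U)` and zero
initial value, the output distribution is a function `g ∈ L¹_loc([0, ∞), Y)`, with a uniform
`L¹`-estimate of `g` by the input. -/
def IsL1LILOStable (S : SystemNode U X Y) : Prop :=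
  ∃ c : ℝ, 0 < c ∧ ∀ (u : ℝ → U) (x : ℝ → S.T.Xneg S.μ)
    (y : 𝓓'((⊤ : TopologicalSpace.Opens ℝ), Y)),
    S.IsGeneralisedSolution 0 u x y →
    ∃ g : ℝ → Y, LocallyIntegrableOn g (Ici 0) ∧ y = distOf g ∧
      ∀ t : ℝ, 0 < t → (∫ s in (0 : ℝ)..t, ‖g s‖) ≤ c * ∫ s in (0 : ℝ)..t, ‖u s‖

end SystemNode

end

/-! After applying `R(μ, A₋₁)`, trajectories with zero initial value are described by bounded
operators on `X`. Put `inOp = R(μ, A₋₁) B` and `outOp = C R(μ, A)`. A pair `(x, u)` lies in `D(C&D)`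
exactly when `x = inOp u + R(μ, A) w` for some `w` in `X`, and then `C&D (x, u) = outOp w + feedOp
u` (`CD_eq`). The state seen through `R(μ, A₋₁)` is the convolution `z` of the semigroup with `inOp
u` (`resState`), and it satisfies `z = A₋₁ ∫z + ∫ inOp u` (`C0Semigroup.res_conv`). Two factors `μ -
A` separate `z` from `w`. Integrating twice absorbs both, so the twice integrated output `output₂ u`
is an expression in `z`, primitives and bounded operators only.

Hence `u ↦ output₂ u` is linear, its value at `t` is bounded by the `L¹` norm of `u` on `[0, t]`
(`exists_norm_output₂_le`), and it commutes with integration (`output₂_primitive`). The output of a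
generalised solution is the second distributional derivative of `output₂ u`
(`output₂_of_isGeneralisedSolution`). If `u = ∫∫φ` with `φ` continuous, then `output₂ φ` is the
output of a classical solution with input `u` (`isClassicalSolution_state₂`).

`L¹` stability gives smooth stability because a classical solution with `x 0 = 0` is a generalised
one, and a locally integrable function is determined almost everywhere by its distribution.

For the converse, approximate `u` in `L¹_loc` by `v n` in `C_c^∞((0, ∞), U)`. The smooth estimate,
applied to differences, makes the outputs `output₂ (v n)''` Cauchy in `L¹_loc`; let `g` be their
limit. Since `output₂` commutes with integration, `∫∫g = lim ∫∫ output₂ (v n)'' = lim output₂ (v n)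
= output₂ u`. So the output distribution of `u` is `g`, and the estimate passes to the limit. -/

namespace HalfLine

variable {E F : Type*} [NormedAddCommGroup E] [NormedAddCommGroup F]

/-! ### Locally integrable functions on the half-line -/

theorem intervalIntegrable {h : ℝ → E} (hh : LocallyIntegrableOn h (Ici 0)) {a b : ℝ}
    (ha : 0 ≤ a) (hb : 0 ≤ b) : IntervalIntegrable h volume a b := by
  rw [intervalIntegrable_iff]
  have hs : uIcc a b ⊆ Ici 0 := fun s hs => (le_min ha hb).trans hs.1
  exact (hh.integrableOn_compact_subset hs isCompact_uIcc).mono_set uIoc_subset_uIcc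

theorem locallyIntegrableOn_of_intervalIntegrable {h : ℝ → E}
    (hh : ∀ t, 0 ≤ t → IntervalIntegrable h volume 0 t) : LocallyIntegrableOn h (Ici 0) := by
  rw [locallyIntegrableOn_iff isClosed_Ici.isLocallyClosed]
  intro k hk hc
  obtain ⟨M, hM⟩ := hc.bddAbove
  have h1 : IntegrableOn h (Icc 0 (max M 0)) :=
    (integrableOn_Icc_iff_integrableOn_Ioc).2
      ((intervalIntegrable_iff_integrableOn_Ioc_of_le (le_max_right _ _)).1
        (hh _ (le_max_right _ _)))
  exact h1.mono_set fun s hs => ⟨hk hs, (hM hs).trans (le_max_left _ _)⟩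

theorem locallyIntegrableOn_of_continuousOn {h : ℝ → E} (hh : ContinuousOn h (Ici 0)) :
    LocallyIntegrableOn h (Ici 0) :=
  hh.locallyIntegrableOn measurableSet_Ici

theorem locallyIntegrableOn_congr {h k : ℝ → E} (hh : LocallyIntegrableOn h (Ici 0))
    (e : EqOn h k (Ici 0)) : LocallyIntegrableOn k (Ici 0) :=
  locallyIntegrableOn_of_intervalIntegrable fun _ ht =>
    (intervalIntegrable hh le_rfl ht).congr
      fun _ hs => e ((le_min le_rfl ht).trans hs.1.le)

theorem integrable_prod_snd {h : ℝ → E} (hh : LocallyIntegrableOn h (Ici 0)) {t : ℝ} (ht : 0 ≤ t) :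
    Integrable (fun p : ℝ × ℝ => h p.2)
      ((volume.restrict (Ioc 0 t)).prod (volume.restrict (Ioc 0 t))) := by
  have h1 : Integrable h (volume.restrict (Ioc 0 t)) :=
    (intervalIntegrable_iff_integrableOn_Ioc_of_le ht).1 (intervalIntegrable hh le_rfl ht)
  exact h1.comp_snd _

variable [NormedSpace ℝ E] [NormedSpace ℝ F]

theorem locallyIntegrableOn_clm (L : E →L[ℝ] F) {h : ℝ → E} (hh : LocallyIntegrableOn h (Ici 0)) :
    LocallyIntegrableOn (fun t => L (h t)) (Ici 0) :=
  locallyIntegrableOn_of_intervalIntegrable fun _ ht =>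
    ⟨L.integrable_comp (intervalIntegrable hh le_rfl ht).1,
      L.integrable_comp (intervalIntegrable hh le_rfl ht).2⟩

/-! ### Iterated primitives -/

/-- The primitive `t ↦ ∫_0^t h`. -/
noncomputable def primitive (h : ℝ → E) : ℝ → E := fun t => ∫ s in (0 : ℝ)..t, h s

@[simp]
theorem primitive_zero (h : ℝ → E) : primitive h 0 = 0 := by simp [primitive]

theorem primitive_congr {h k : ℝ → E} (e : EqOn h k (Ici 0)) :
    EqOn (primitive h) (primitive k) (Ici 0) := fun _ ht =>
  intervalIntegral.integral_congr fun _ hs => e ((le_min le_rfl ht).trans hs.1)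

theorem continuousOn_primitive {h : ℝ → E} (hh : LocallyIntegrableOn h (Ici 0)) :
    ContinuousOn (primitive h) (Ici 0) := by
  intro t ht
  have h1 : ContinuousOn (primitive h) (uIcc 0 (t + 1)) :=
    intervalIntegral.continuousOn_primitive_interval'
      (intervalIntegrable hh le_rfl (by linarith [mem_Ici.1 ht])) left_mem_uIcc
  rw [uIcc_of_le (by linarith [mem_Ici.1 ht])] at h1
  refine (h1 t ⟨ht, by linarith⟩).mono_of_mem_nhdsWithin ?_
  filter_upwards [self_mem_nhdsWithin, mem_nhdsWithin_of_mem_nhds (Iio_mem_nhds (lt_add_one t))]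
    with s h1 h2 using ⟨h1, h2.le⟩

theorem locallyIntegrableOn_primitive {h : ℝ → E} (hh : LocallyIntegrableOn h (Ici 0)) :
    LocallyIntegrableOn (primitive h) (Ici 0) :=
  locallyIntegrableOn_of_continuousOn (continuousOn_primitive hh)

theorem primitive_clm [CompleteSpace E] [CompleteSpace F] (L : E →L[ℝ] F) {h : ℝ → E}
    (hh : LocallyIntegrableOn h (Ici 0)) {t : ℝ} (ht : 0 ≤ t) :
    primitive (fun s => L (h s)) t = L (primitive h t) :=
  L.intervalIntegral_comp_comm (intervalIntegrable hh le_rfl ht)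

theorem primitive_add {h k : ℝ → E} (hh : LocallyIntegrableOn h (Ici 0))
    (hk : LocallyIntegrableOn k (Ici 0)) {t : ℝ} (ht : 0 ≤ t) :
    primitive (fun s => h s + k s) t = primitive h t + primitive k t :=
  intervalIntegral.integral_add (intervalIntegrable hh le_rfl ht) (intervalIntegrable hk le_rfl ht)

theorem primitive_sub {h k : ℝ → E} (hh : LocallyIntegrableOn h (Ici 0))
    (hk : LocallyIntegrableOn k (Ici 0)) {t : ℝ} (ht : 0 ≤ t) :
    primitive (fun s => h s - k s) t = primitive h t - primitive k t :=
  intervalIntegral.integral_sub (intervalIntegrable hh le_rfl ht) (intervalIntegrable hk le_rfl ht)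

theorem primitive_sub_of_eq {f g k : ℝ → E} (hg : LocallyIntegrableOn g (Ici 0))
    (hk : LocallyIntegrableOn k (Ici 0)) (e : ∀ s, 0 ≤ s → f s = g s - k s) {t : ℝ} (ht : 0 ≤ t) :
    primitive f t = primitive g t - primitive k t :=
  (primitive_congr (fun s hs => e s hs) ht).trans (primitive_sub hg hk ht)

theorem primitive_clm_add [CompleteSpace E] [CompleteSpace F] {G : Type*} [NormedAddCommGroup G]
    [NormedSpace ℝ G] [CompleteSpace G] (L : E →L[ℝ] G) (M : F →L[ℝ] G) {f : ℝ → E} {g : ℝ → F}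
    {k : ℝ → G} (hf : LocallyIntegrableOn f (Ici 0)) (hg : LocallyIntegrableOn g (Ici 0))
    (e : ∀ s, 0 ≤ s → k s = L (f s) + M (g s)) (t : ℝ) (ht : 0 ≤ t) :
    primitive k t = L (primitive f t) + M (primitive g t) := by
  rw [primitive_congr (fun s hs => e s hs) ht, ← primitive_clm L hf ht, ← primitive_clm M hg ht]
  exact primitive_add (locallyIntegrableOn_clm L hf) (locallyIntegrableOn_clm M hg) ht

theorem primitive_smul {G : Type*} [NormedAddCommGroup G] [NormedSpace ℂ G] (c : ℂ) (h : ℝ → G)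
    (t : ℝ) : primitive (fun s => c • h s) t = c • primitive h t :=
  intervalIntegral.integral_smul c h

theorem hasDerivWithinAt_primitive [CompleteSpace E] {h : ℝ → E} (hh : ContinuousOn h (Ici 0))
    {t : ℝ} (ht : 0 ≤ t) : HasDerivWithinAt (primitive h) (h t) (Ici 0) t := by
  rcases ht.eq_or_lt with rfl | ht'
  · exact intervalIntegral.integral_hasDerivWithinAt_right (s := Ici 0) (t := Ioi 0)
      (by simp) ((hh.mono Ioi_subset_Ici_self).stronglyMeasurableAtFilter_nhdsWithin
        measurableSet_Ioi 0) ((hh 0 ht).mono Ioi_subset_Ici_self)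
  · refine (intervalIntegral.integral_hasDerivAt_right
      (intervalIntegrable (locallyIntegrableOn_of_continuousOn hh) le_rfl ht)
      ?_ ((hh t ht).continuousAt (Ici_mem_nhds ht'))).hasDerivWithinAt
    exact (hh.mono Ioi_subset_Ici_self).stronglyMeasurableAtFilter isOpen_Ioi t ht'

theorem primitive_deriv [CompleteSpace E] {h h' : ℝ → E}
    (hd : ∀ t, 0 ≤ t → HasDerivWithinAt h (h' t) (Ici 0) t) (hc : ContinuousOn h' (Ici 0))
    {t : ℝ} (ht : 0 ≤ t) : primitive h' t = h t - h 0 := by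
  refine intervalIntegral.integral_eq_sub_of_hasDerivAt_of_le ht
    (fun s hs => ((hd s hs.1).continuousWithinAt).mono Icc_subset_Ici_self)
    (fun s hs => (hd s hs.1.le).hasDerivAt (Ici_mem_nhds hs.1))
    (intervalIntegrable (locallyIntegrableOn_of_continuousOn hc) le_rfl ht)

theorem norm_primitive_le_of_le {h : ℝ → E} {K t : ℝ}
    (hK : ∀ s, 0 ≤ s → s ≤ t → ‖h s‖ ≤ K) {s : ℝ} (hs : 0 ≤ s) (hst : s ≤ t) :
    ‖primitive h s‖ ≤ K * t := by
  have hK0 : 0 ≤ K := (norm_nonneg _).trans (hK 0 le_rfl (hs.trans hst))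
  have := intervalIntegral.norm_integral_le_of_norm_le_const (a := 0) (b := s) (C := K) (f := h)
    (fun r hr => by
      rw [uIoc_of_le hs] at hr
      exact hK r hr.1.le (hr.2.trans hst))
  rw [sub_zero, abs_of_nonneg hs] at this
  exact this.trans (mul_le_mul_of_nonneg_left hst hK0)

theorem norm_primitive_le_integral_norm {h : ℝ → E} (hh : LocallyIntegrableOn h (Ici 0)) {s t : ℝ}
    (hs : 0 ≤ s) (hst : s ≤ t) : ‖primitive h s‖ ≤ ∫ r in (0 : ℝ)..t, ‖h r‖ :=
  (intervalIntegral.norm_integral_le_integral_norm hs).trans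
    (intervalIntegral.integral_mono_interval le_rfl hs hst
      (Eventually.of_forall fun _ => norm_nonneg _)
      (intervalIntegrable hh le_rfl (hs.trans hst)).norm)

/-- Interchange of the order of integration over the triangle `0 ≤ r ≤ s ≤ t`. -/
theorem integral_triangle_swap {f : ℝ → ℝ → E} {t : ℝ} (ht : 0 ≤ t)
    (hf : Integrable (Function.uncurry f)
      ((volume.restrict (Ioc 0 t)).prod (volume.restrict (Ioc 0 t)))) :
    ∫ s in (0 : ℝ)..t, ∫ r in (0 : ℝ)..s, f s r = ∫ r in (0 : ℝ)..t, ∫ s in r..t, f s r := by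
  -- The variable limits become the indicator of the triangle, so that Fubini on the square applies.
  set g : ℝ → ℝ → E := fun s r => {p : ℝ × ℝ | p.2 ≤ p.1}.indicator (Function.uncurry f) (s, r)
    with hg
  have hm : MeasurableSet {p : ℝ × ℝ | p.2 ≤ p.1} := measurableSet_le measurable_snd measurable_fst
  have hgi : Integrable (Function.uncurry g)
      ((volume.restrict (Ioc 0 t)).prod (volume.restrict (Ioc 0 t))) := hf.indicator hm
  have h1 := integral_integral_swap hgi
  rw [intervalIntegral.integral_of_le ht, intervalIntegral.integral_of_le ht]
  refine Eq.trans ?_ (h1.trans ?_)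
  · refine setIntegral_congr_fun measurableSet_Ioc fun s hs => ?_
    have e : g s = (Iic s).indicator (f s) := by
      ext r; simp [hg, indicator]
    simp only [e]
    rw [intervalIntegral.integral_of_le hs.1.le, setIntegral_indicator measurableSet_Iic,
      Ioc_inter_Iic, min_eq_right hs.2]
  · refine setIntegral_congr_fun measurableSet_Ioc fun r hr => ?_
    have e : (fun s => g s r) = (Ici r).indicator (fun s => f s r) := by
      ext s; simp [hg, indicator]
    simp only [e]
    rw [intervalIntegral.integral_of_le hr.2, setIntegral_indicator measurableSet_Ici,
      ← integral_Icc_eq_integral_Ioc]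
    congr 2
    ext s
    exact ⟨fun h => ⟨h.2, h.1.2⟩, fun h => ⟨⟨hr.1.trans_le h.1, h.2⟩, h.1⟩⟩

theorem primitive_primitive [CompleteSpace E] {h : ℝ → E} (hh : LocallyIntegrableOn h (Ici 0))
    {t : ℝ} (ht : 0 ≤ t) :
    primitive (primitive h) t = ∫ s in (0 : ℝ)..t, (t - s) • h s := by
  have := integral_triangle_swap (f := fun _ r => h r) ht (integrable_prod_snd hh ht)
  simpa [primitive] using this

/-! ### Distributions given by locally integrable functions on the half-line -/

open SystemNode in
theorem distOf_congr {Y : Type*} [NormedAddCommGroup Y] [NormedSpace ℂ Y] {f g : ℝ → Y}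
    (hf : LocallyIntegrableOn f (Ici 0)) (e : EqOn f g (Ici 0)) : distOf f = distOf g := by
  refine DFunLike.ext _ _ fun φ => ?_
  rw [distOf_apply f hf, distOf_apply g (locallyIntegrableOn_congr hf e)]
  exact setIntegral_congr_fun measurableSet_Ici fun t ht => by simp only [e ht]

open SystemNode in
-- The primitive vanishes at `0`, so its extension by zero has no jump there and no point mass
-- appears. Fubini turns `∫ φ'(s) ∫_0^s h` into `∫ (φ(M) - φ(r)) h(r) dr`, and `φ(M) = 0` for `M`
-- beyond the support.
theorem lineDeriv_distOf_primitive {Y : Type*} [NormedAddCommGroup Y] [NormedSpace ℂ Y]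
    [CompleteSpace Y] {h : ℝ → Y} (hh : LocallyIntegrableOn h (Ici 0)) :
    ∂_{(1 : ℝ)} (distOf (primitive h)) = distOf h := by
  refine DFunLike.ext _ _ fun φ => ?_
  rw [Distribution.lineDerivOp_apply_apply, map_neg,
    distOf_apply _ (locallyIntegrableOn_primitive hh), distOf_apply _ hh]
  have hd : ∀ t, (∂_{(1 : ℝ)} φ) t = deriv φ t := fun t => by
    rw [TestFunction.lineDerivOp_eq_lineDerivCLM ℝ, TestFunction.lineDerivCLM_apply,
      if_pos (by simp), (φ.contDiff.differentiable (by simp)).differentiableAt.lineDeriv_eq_fderiv,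
      fderiv_apply_one_eq_deriv]
  obtain ⟨N, hN⟩ := φ.hasCompactSupport.isCompact.bddAbove
  -- Adding `1` puts `M` strictly outside the support of `φ`.
  set M := max N 0 + 1 with hM
  have hM0 : 0 ≤ M := by positivity
  have hout : ∀ t, M ≤ t → t ∉ tsupport φ := fun t ht hs => by
    have := hN hs
    have := le_max_left N 0
    linarith
  have h1 : ∀ k : ℝ → Y, (∀ t, M < t → k t = 0) →
      ∫ t in Ici (0 : ℝ), k t = ∫ t in (0 : ℝ)..M, k t := fun k hk => by
    rw [integral_Ici_eq_integral_Ioi, intervalIntegral.integral_of_le hM0]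
    refine setIntegral_eq_of_subset_of_forall_sdiff_eq_zero measurableSet_Ioi
      (fun _ hs => hs.1) (fun t ht => hk t ?_)
    by_contra hc
    exact ht.2 ⟨ht.1, not_lt.1 hc⟩
  have hφc : Continuous (deriv φ) := φ.contDiff.continuous_deriv (by simp)
  rw [h1 _ fun t ht => ?_, h1 _ fun t ht => ?_]
  · have hint : Integrable (Function.uncurry fun s r => deriv φ s • h r)
        ((volume.restrict (Ioc 0 M)).prod (volume.restrict (Ioc 0 M))) :=
      Integrable.smul_prod
        ((intervalIntegrable_iff_integrableOn_Ioc_of_le hM0).1 (hφc.intervalIntegrable 0 M))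
        ((intervalIntegrable_iff_integrableOn_Ioc_of_le hM0).1 (intervalIntegrable hh le_rfl hM0))
    have h2 := integral_triangle_swap hM0 hint
    simp only [intervalIntegral.integral_smul, intervalIntegral.integral_smul_const] at h2
    simp only [hd, primitive]
    rw [h2, ← intervalIntegral.integral_neg]
    refine intervalIntegral.integral_congr fun r hr => ?_
    rw [intervalIntegral.integral_deriv_eq_sub
      (fun x _ => (φ.contDiff.differentiable (by simp)) x) (hφc.intervalIntegrable _ _),
      image_eq_zero_of_notMem_tsupport (hout M le_rfl)]
    simp
  · rw [image_eq_zero_of_notMem_tsupport (hout t ht.le), zero_smul]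
  · rw [hd, Function.notMem_support.1 fun hs => hout t ht.le (support_deriv_subset hs), zero_smul]

open SystemNode in
theorem ae_eq_of_distOf_eq {Y : Type*} [NormedAddCommGroup Y] [NormedSpace ℂ Y]
    [CompleteSpace Y] {f g : ℝ → Y} (hf : LocallyIntegrableOn f (Ici 0))
    (hg : LocallyIntegrableOn g (Ici 0)) (e : distOf f = distOf g) :
    ∀ᵐ t ∂(volume.restrict (Ici (0 : ℝ))), f t = g t := by
  have hf' := (locallyIntegrableOn_iff_locallyIntegrable_restrict isClosed_Ici).1 hf
  have hg' := (locallyIntegrableOn_iff_locallyIntegrable_restrict isClosed_Ici).1 hg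
  refine ae_eq_of_integral_contDiff_smul_eq hf' hg' fun φ hφ hφc => ?_
  have h1 := DFunLike.congr_fun e
    (⟨φ, hφ, hφc, by simp⟩ : 𝓓((⊤ : TopologicalSpace.Opens ℝ), ℝ))
  rwa [distOf_apply f hf, distOf_apply g hg] at h1

end HalfLine

namespace C0Semigroup

open HalfLine

variable {X : Type*} [NormedAddCommGroup X] [NormedSpace ℂ X]

/-! ### Convolution with the semigroup -/

/-- The convolution `t ↦ ∫_0^t T (t - s) h(s) ds`. -/
noncomputable def conv (T : C0Semigroup X) (h : ℝ → X) : ℝ → X :=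
  fun t => ∫ s in (0 : ℝ)..t, T.op (max (t - s) 0) (h s)

theorem conv_congr (T : C0Semigroup X) {h k : ℝ → X} (e : EqOn h k (Ici 0)) :
    EqOn (T.conv h) (T.conv k) (Ici 0) := fun t ht =>
  intervalIntegral.integral_congr fun s hs => by
    simp only [e ((le_min le_rfl ht).trans hs.1)]

variable [CompleteSpace X]

theorem exists_norm_op_le (T : C0Semigroup X) (t : ℝ) :
    ∃ K : ℝ, 0 ≤ K ∧ ∀ s, s ≤ t → ‖T.op (max s 0)‖ ≤ K := by
  obtain ⟨w, M, h⟩ := T.exists_exponential_bound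
  refine ⟨|M| * Real.exp (|w| * max t 0), by positivity, fun s hs => ?_⟩
  refine (h _ (le_max_right _ _)).trans (mul_le_mul (le_abs_self M) (Real.exp_le_exp.2 ?_)
    (Real.exp_nonneg _) (abs_nonneg M))
  exact mul_le_mul (le_abs_self w) (max_le_max_right 0 hs) (le_max_right _ _) (abs_nonneg w)

/-- Only nonnegative times are meaningful. Truncating time at `0` gives a jointly continuous map on
all of `ℝ × X`, which settles measurability in the Fubini arguments. The truncation is inactive on
the domains of integration that matter. -/
theorem continuous_op_max (T : C0Semigroup X) :
    Continuous fun p : ℝ × X => T.op (max p.1 0) p.2 := by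
  have h1 : ∀ x, Continuous fun t : ℝ => T.op (max t 0) x := fun x =>
    (T.continuousOn_orbit x).comp_continuous (by fun_prop) fun _ => mem_Ici.2 (le_max_right _ _)
  refine continuous_iff_continuousAt.2 fun p => ?_
  obtain ⟨K, -, hK⟩ := T.exists_norm_op_le (p.1 + 1)
  refine tendsto_iff_norm_sub_tendsto_zero.2 ?_
  have hlim : Tendsto (fun q : ℝ × X =>
      K * ‖q.2 - p.2‖ + ‖T.op (max q.1 0) p.2 - T.op (max p.1 0) p.2‖) (𝓝 p) (𝓝 0) := by
    have : Continuous fun q : ℝ × X =>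
        K * ‖q.2 - p.2‖ + ‖T.op (max q.1 0) p.2 - T.op (max p.1 0) p.2‖ := by
      have := (h1 p.2).comp (continuous_fst (X := ℝ) (Y := X))
      simp only [Function.comp_def] at this
      fun_prop
    simpa using this.tendsto p
  refine squeeze_zero' (Eventually.of_forall fun _ => norm_nonneg _) ?_ hlim
  filter_upwards [(continuous_fst.tendsto p).eventually (Iio_mem_nhds (lt_add_one p.1))] with q hq
  have e : T.op (max q.1 0) q.2 - T.op (max p.1 0) p.2 = T.op (max q.1 0) (q.2 - p.2) +
      (T.op (max q.1 0) p.2 - T.op (max p.1 0) p.2) := by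
    rw [map_sub]; abel
  rw [e]
  exact (norm_add_le _ _).trans
    (add_le_add_left ((T.op _).le_of_opNorm_le (hK _ (le_of_lt hq)) _) _)

theorem integrable_op_max (T : C0Semigroup X) {α : Type*} [MeasurableSpace α] {m : Measure α}
    {a : α → ℝ} {g : α → X} {t : ℝ} (ha : AEStronglyMeasurable a m) (hat : ∀ᵐ p ∂m, a p ≤ t)
    (hg : Integrable g m) : Integrable (fun p => T.op (max (a p) 0) (g p)) m := by
  obtain ⟨K, -, hK⟩ := T.exists_norm_op_le t
  refine (hg.norm.const_mul K).mono'
    (T.continuous_op_max.comp_aestronglyMeasurable (ha.prodMk hg.aestronglyMeasurable)) ?_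
  filter_upwards [hat] with p hp
  exact (T.op _).le_of_opNorm_le (hK _ hp) _

theorem intervalIntegrable_conv (T : C0Semigroup X) {h : ℝ → X}
    (hh : LocallyIntegrableOn h (Ici 0)) {t : ℝ} (ht : 0 ≤ t) (a : ℝ) :
    IntervalIntegrable (fun s => T.op (max (a - s) 0) (h s)) volume 0 t := by
  rw [intervalIntegrable_iff_integrableOn_Ioc_of_le ht]
  refine T.integrable_op_max (t := a) (by fun_prop) ?_
    ((intervalIntegrable_iff_integrableOn_Ioc_of_le ht).1 (intervalIntegrable hh le_rfl ht))
  filter_upwards [ae_restrict_mem measurableSet_Ioc] with s hs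
  linarith [hs.1]

theorem conv_sub (T : C0Semigroup X) {h k : ℝ → X} (hh : LocallyIntegrableOn h (Ici 0))
    (hk : LocallyIntegrableOn k (Ici 0)) {t : ℝ} (ht : 0 ≤ t) :
    T.conv (fun s => h s - k s) t = T.conv h t - T.conv k t := by
  simp only [conv, map_sub]
  exact intervalIntegral.integral_sub (T.intervalIntegrable_conv hh ht t)
    (T.intervalIntegrable_conv hk ht t)

theorem conv_clm (T : C0Semigroup X) (L : X →L[ℂ] X)
    (hL : ∀ t : ℝ, 0 ≤ t → ∀ x, L (T.op t x) = T.op t (L x)) {h : ℝ → X}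
    (hh : LocallyIntegrableOn h (Ici 0)) {t : ℝ} (ht : 0 ≤ t) :
    T.conv (fun s => L (h s)) t = L (T.conv h t) := by
  simp only [conv, ← hL _ (le_max_right _ _)]
  exact (L.restrictScalars ℝ).intervalIntegral_comp_comm (T.intervalIntegrable_conv hh ht t)

theorem exists_norm_conv_le (T : C0Semigroup X) (t : ℝ) :
    ∃ K : ℝ, 0 ≤ K ∧ ∀ h : ℝ → X, LocallyIntegrableOn h (Ici 0) → ∀ s, 0 ≤ s → s ≤ t →
      ‖T.conv h s‖ ≤ K * ∫ r in (0 : ℝ)..t, ‖h r‖ := by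
  obtain ⟨K, hK0, hK⟩ := T.exists_norm_op_le t
  refine ⟨K, hK0, fun h hh s hs hst => ?_⟩
  have hi := (intervalIntegrable hh le_rfl hs).norm
  have h1 : ‖T.conv h s‖ ≤ ∫ r in (0 : ℝ)..s, K * ‖h r‖ := by
    refine intervalIntegral.norm_integral_le_of_norm_le hs ?_ (hi.const_mul K)
    refine Eventually.of_forall fun r hr => ?_
    exact (T.op _).le_of_opNorm_le (hK _ (by linarith [hr.1])) _
  rw [intervalIntegral.integral_const_mul] at h1
  refine h1.trans (mul_le_mul_of_nonneg_left ?_ hK0)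
  exact intervalIntegral.integral_mono_interval le_rfl hs hst
    (Eventually.of_forall fun _ => norm_nonneg _) (intervalIntegrable hh le_rfl (hs.trans hst)).norm

theorem continuousOn_conv (T : C0Semigroup X) {h : ℝ → X} (hh : LocallyIntegrableOn h (Ici 0)) :
    ContinuousOn (T.conv h) (Ici 0) := by
  intro t ht
  have ht0 : (0 : ℝ) ≤ t := ht
  set N := t + 1 with hN
  have hN0 : 0 ≤ N := by linarith
  obtain ⟨K, hK0, hK⟩ := T.exists_norm_op_le N
  -- The moving endpoint is put into an indicator on the fixed interval `[0, N]`, and dominated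
  -- convergence applies. The integrand is continuous in `a` at `t` for every `s ≠ t`, hence for
  -- almost every `s`.
  set g : ℝ → ℝ → X := fun a s => (Iic a).indicator (fun s => T.op (max (a - s) 0) (h s)) s with hg
  have key : ContinuousAt (fun a => ∫ s in (0 : ℝ)..N, g a s) t := by
    refine intervalIntegral.continuousAt_of_dominated_interval (bound := fun s => K * ‖h s‖)
      ?_ ?_ ((intervalIntegrable hh le_rfl hN0).norm.const_mul K) ?_
    · refine Eventually.of_forall fun a => ?_
      have := (T.intervalIntegrable_conv hh hN0 a).1.aestronglyMeasurable
      rw [uIoc_of_le hN0]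
      exact this.indicator measurableSet_Iic
    · filter_upwards [Iio_mem_nhds (lt_add_one t)] with a ha
      refine Eventually.of_forall fun s hs => ?_
      rw [uIoc_of_le hN0] at hs
      refine (norm_indicator_le_norm_self _ _).trans ?_
      exact (T.op _).le_of_opNorm_le (hK _ (by linarith [hs.1, mem_Iio.1 ha])) _
    · have : ∀ᵐ s : ℝ, s ≠ t := by
        simp [ae_iff, measure_singleton]
      filter_upwards [this] with s hst _
      have hc : Continuous fun a : ℝ => T.op (max (a - s) 0) (h s) :=
        T.continuous_op_max.comp (by fun_prop : Continuous fun a : ℝ => (a - s, h s))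
      rcases lt_or_gt_of_ne hst with hlt | hgt
      · refine hc.continuousAt.congr ?_
        filter_upwards [Ioi_mem_nhds hlt] with a ha
        simp [hg, le_of_lt (mem_Ioi.1 ha)]
      · refine (continuousAt_const (y := (0 : X))).congr ?_
        filter_upwards [Iio_mem_nhds hgt] with a ha
        simp [hg, mem_Iio.1 ha]
  refine key.continuousWithinAt.congr_of_eventuallyEq_of_mem ?_ ht
  filter_upwards [self_mem_nhdsWithin, mem_nhdsWithin_of_mem_nhds (Iio_mem_nhds (lt_add_one t))]
    with a ha0 haN
  have ha0 : (0 : ℝ) ≤ a := ha0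
  rw [conv, intervalIntegral.integral_of_le ha0, intervalIntegral.integral_of_le hN0]
  simp only [hg]
  rw [setIntegral_indicator measurableSet_Iic, Ioc_inter_Iic, min_eq_right (le_of_lt haN)]

theorem locallyIntegrableOn_conv (T : C0Semigroup X) {h : ℝ → X}
    (hh : LocallyIntegrableOn h (Ici 0)) : LocallyIntegrableOn (T.conv h) (Ici 0) :=
  locallyIntegrableOn_of_continuousOn (T.continuousOn_conv hh)

/-- Fubini on the triangle, then a shift in the inner integral. The result contains integrals of
orbits over `[0, t - r]`, the form that `integral_op_res` evaluates. -/
theorem primitive_conv (T : C0Semigroup X) {h : ℝ → X} (hh : LocallyIntegrableOn h (Ici 0))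
    {t : ℝ} (ht : 0 ≤ t) : primitive (T.conv h) t =
      ∫ r in (0 : ℝ)..t, ∫ s in (0 : ℝ)..t - r, T.op (max s 0) (h r) := by
  have hi := T.integrable_op_max (a := fun p : ℝ × ℝ => p.1 - p.2) (t := t)
    (Continuous.aestronglyMeasurable (by fun_prop)) ?_ (integrable_prod_snd hh ht)
  · refine (integral_triangle_swap (f := fun s r => T.op (max (s - r) 0) (h r)) ht hi).trans ?_
    refine intervalIntegral.integral_congr fun r _ => ?_
    simpa using intervalIntegral.integral_comp_sub_right
      (fun s => T.op (max s 0) (h r)) (a := r) (b := t) r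
  · rw [Measure.prod_restrict]
    filter_upwards [ae_restrict_mem (measurableSet_Ioc.prod measurableSet_Ioc)] with p hp
    linarith [hp.1.2, hp.2.1]

/-- Convolution with the semigroup commutes with taking primitives. -/
theorem conv_primitive (T : C0Semigroup X) {h : ℝ → X} (hh : LocallyIntegrableOn h (Ici 0))
    {t : ℝ} (ht : 0 ≤ t) : T.conv (primitive h) t = primitive (T.conv h) t := by
  rw [T.primitive_conv hh ht]
  have hi := T.integrable_op_max (a := fun p : ℝ × ℝ => t - p.1) (t := t)
    (Continuous.aestronglyMeasurable (by fun_prop)) ?_ (integrable_prod_snd hh ht)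
  -- Swapping the integrals and reflecting the inner variable by `s ↦ t - s` yields the same
  -- iterated integral as in `primitive_conv`.
  · have h1 : T.conv (primitive h) t =
        ∫ s in (0 : ℝ)..t, ∫ r in (0 : ℝ)..s, T.op (max (t - s) 0) (h r) := by
      refine intervalIntegral.integral_congr fun s hs => ?_
      exact (((T.op (max (t - s) 0)).restrictScalars ℝ).intervalIntegral_comp_comm
        (intervalIntegrable hh le_rfl ((le_min le_rfl ht).trans hs.1))).symm
    rw [h1]
    refine (integral_triangle_swap (f := fun s r => T.op (max (t - s) 0) (h r)) ht hi).trans ?_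
    refine intervalIntegral.integral_congr fun r _ => ?_
    simpa using intervalIntegral.integral_comp_sub_left
      (fun s => T.op (max s 0) (h r)) (a := r) (b := t) t
  · rw [Measure.prod_restrict]
    filter_upwards [ae_restrict_mem (measurableSet_Ioc.prod measurableSet_Ioc)] with p hp
    linarith [hp.1.1]

/-- The vector `z R(z, A) x - x` is `A R(z, A) x`, so the integrand is the derivative of the orbit
of `R(z, A) x`. The generator is a right derivative at `0`, which the semigroup law moves to any
`s`; the fundamental theorem for right derivatives suffices. -/
theorem integral_op_res (T : C0Semigroup X) (z : T.rho) (x : X) {t : ℝ} (ht : 0 ≤ t) :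
    ∫ s in (0 : ℝ)..t, T.op (max s 0) ((z : ℂ) • T.res z x - x) =
      T.res z (T.op t x) - T.res z x := by
  obtain ⟨hm, hx⟩ := (unboundedResolvent_spec T.generator z).1 x
  have hA : T.generator ⟨_, hm⟩ = (z : ℂ) • T.res z x - x := by
    rw [eq_sub_iff_add_eq, ← eq_sub_iff_add_eq']; exact hx.symm
  have h0 := T.hasDerivWithinAt_of_mem ⟨_, hm⟩
  rw [hA] at h0
  have hc : ∀ y, Continuous fun s : ℝ => T.op (max s 0) y := fun y =>
    T.continuous_op_max.comp (by fun_prop : Continuous fun s : ℝ => (s, y))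
  have h1 := intervalIntegral.integral_eq_sub_of_hasDeriv_right_of_le ht
    (f := fun s => T.op s (T.res z x))
    (f' := fun s => T.op (max s 0) ((z : ℂ) • T.res z x - x))
    ((T.continuousOn_orbit _).mono Icc_subset_Ici_self) (fun s hs => ?_)
    ((hc _).intervalIntegrable _ _)
  · rw [h1, T.res_op_comm z ht, T.op_zero]; rfl
  · have hs0 : 0 ≤ s := hs.1.le
    have h2 : HasDerivWithinAt (fun r : ℝ => T.op (r - s) (T.res z x))
        ((z : ℂ) • T.res z x - x) (Ici s) s := by
      have hg : HasDerivWithinAt (fun r : ℝ => T.op r (T.res z x))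
        ((z : ℂ) • T.res z x - x) (Ici 0) (s - s) := by simpa using! h0
      have hk : HasDerivWithinAt (fun r : ℝ => r - s) 1 (Ici s) s :=
        ((hasDerivAt_id s).sub_const s).hasDerivWithinAt
      simpa using! HasDerivWithinAt.scomp (h := fun r : ℝ => r - s) s hg hk
        (fun r hr => by simpa using! hr)
    have h3 := ((T.op s).restrictScalars ℝ).hasFDerivAt.comp_hasDerivWithinAt s h2
    simp only [max_eq_left hs0]
    refine (h3.congr (fun r hr => ?_) ?_).mono Ioi_subset_Ici_self
    · have := T.op_add s (r - s) hs0 (sub_nonneg.2 hr)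
      rw [add_sub_cancel] at this
      rw [this]; rfl
    · simp [T.op_zero]

/-- The integrated evolution equation for convolutions, after applying the resolvent. -/
theorem res_conv (T : C0Semigroup X) (z : T.rho) {h : ℝ → X} (hh : LocallyIntegrableOn h (Ici 0))
    {t : ℝ} (ht : 0 ≤ t) :
    T.res z (T.conv h t) - T.res z (primitive h t) =
      (z : ℂ) • T.res z (primitive (T.conv h) t) - primitive (T.conv h) t := by
  -- `L` is `A R(z, A)`: bounded and commuting with the semigroup, so it passes through the
  -- convolution, and the unbounded `A` is never applied.
  set L : X →L[ℂ] X := (z : ℂ) • T.res z - ContinuousLinearMap.id ℂ X with hL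
  have hLa : ∀ x, L x = (z : ℂ) • T.res z x - x := fun x => rfl
  have hLc : ∀ t : ℝ, 0 ≤ t → ∀ x, L (T.op t x) = T.op t (L x) := fun t ht x => by
    simp [hLa, T.res_op_comm z ht]
  have hLh : LocallyIntegrableOn (fun s => L (h s)) (Ici 0) :=
    locallyIntegrableOn_clm (L.restrictScalars ℝ) hh
  rw [← hLa]
  have h1 : L (primitive (T.conv h) t) = primitive (T.conv fun s => L (h s)) t := by
    rw [primitive_congr (fun s hs => T.conv_clm L hLc hh hs) ht]
    exact (primitive_clm (L.restrictScalars ℝ) (T.locallyIntegrableOn_conv hh) ht).symm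
  rw [h1, T.primitive_conv hLh ht, ← T.conv_clm _ (fun t ht => T.res_op_comm z ht) hh ht]
  have h2 := primitive_clm ((T.res z).restrictScalars ℝ) hh ht
  simp only [ContinuousLinearMap.coe_restrictScalars'] at h2
  have h3 : LocallyIntegrableOn (fun s => T.res z (h s)) (Ici 0) :=
    locallyIntegrableOn_clm ((T.res z).restrictScalars ℝ) hh
  rw [← h2, conv, primitive, ← intervalIntegral.integral_sub
    (T.intervalIntegrable_conv h3 ht t) (intervalIntegrable h3 le_rfl ht)]
  refine intervalIntegral.integral_congr fun r hr => ?_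
  rw [uIcc_of_le ht] at hr
  have h4 := sub_nonneg.2 hr.2
  simp only [hLa, T.integral_op_res z (h r) h4, max_eq_left h4, T.res_op_comm z h4]

end C0Semigroup

/-! ### Reduction of `X₁` and `X₋₁` to bounded operators on `X`. -/

namespace C0Semigroup

variable {X : Type*} [NormedAddCommGroup X] [NormedSpace ℂ X]

/-- The resolvent `R(μ, A)` as an operator `X → X₁`. -/
noncomputable def resX1 (T : C0Semigroup X) (μ : T.rho) : X →L[ℂ] T.X1 μ :=
  (T.toX1 μ ∘ₗ LinearMap.codRestrict T.generator.domain (T.res μ).toLinearMap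
    (T.res_mem μ)).mkContinuous 1 fun x => by
      obtain ⟨h, hx⟩ := (unboundedResolvent_spec T.generator μ).1 x
      rw [one_mul]
      refine (T.norm_toX1 μ ⟨T.res μ x, h⟩).le.trans ?_
      rw [hx]

theorem resX1_apply (T : C0Semigroup X) (μ : T.rho) (x : X) :
    T.resX1 μ x = T.toX1 μ ⟨T.res μ x, T.res_mem μ x⟩ := rfl

variable [CompleteSpace X]

/-! ### The isomorphism `μ - A₋₁ : X → X₋₁` -/

/-- The operator `μ - A₋₁ : X → X₋₁`. -/
noncomputable def shiftNeg (T : C0Semigroup X) (μ : T.rho) : X →L[ℂ] T.Xneg μ :=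
  (μ : ℂ) • T.emb μ - T.genNeg μ

theorem shiftNeg_res (T : C0Semigroup X) (μ : T.rho) (x : X) :
    T.shiftNeg μ (T.res μ x) = T.emb μ x := by
  obtain ⟨h, hx⟩ := (unboundedResolvent_spec T.generator μ).1 x
  have : T.shiftNeg μ (T.res μ x) = (μ : ℂ) • T.emb μ (T.res μ x) - T.genNeg μ (T.res μ x) := rfl
  rw [this, T.genNeg_coe μ ⟨_, h⟩, ← map_smul, ← map_sub, hx]

theorem shiftNeg_resNeg (T : C0Semigroup X) (μ : T.rho) (v : T.Xneg μ) :
    T.shiftNeg μ (T.resNeg μ μ v) = v := by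
  refine (T.denseRange_emb μ).induction_on
    (p := fun v => T.shiftNeg μ (T.resNeg μ μ v) = v) v
    (isClosed_eq (by fun_prop) (by fun_prop)) fun x => ?_
  rw [ContinuousLinearMap.coe_coe, resNeg_emb, shiftNeg_res]

theorem resNeg_injective (T : C0Semigroup X) (μ : T.rho) : Function.Injective (T.resNeg μ μ) :=
  Function.LeftInverse.injective (T.shiftNeg_resNeg μ)

/-- The extended semigroup is conjugate to the original one through the isomorphism `μ - A₋₁`: both
sides are continuous and agree on the dense image of `X`. Convolutions in `X₋₁` can therefore be
computed in `X`. -/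
theorem opNeg_eq (T : C0Semigroup X) (μ : T.rho) {t : ℝ} (ht : 0 ≤ t) (v : T.Xneg μ) :
    T.opNeg μ t v = T.shiftNeg μ (T.op t (T.resNeg μ μ v)) := by
  refine (T.denseRange_emb μ).induction_on
    (p := fun v => T.opNeg μ t v = T.shiftNeg μ (T.op t (T.resNeg μ μ v))) v
    (isClosed_eq (by fun_prop) (by fun_prop)) fun x => ?_
  rw [ContinuousLinearMap.coe_coe, resNeg_emb, T.opNeg_emb μ ht, ← T.res_op_comm μ ht,
    shiftNeg_res]

theorem resNeg_sub_resNeg (T : C0Semigroup X) (μ a b : T.rho) (v : T.Xneg μ) :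
    T.resNeg μ a v - T.resNeg μ b v = ((b : ℂ) - a) • T.res a (T.resNeg μ b v) := by
  refine (T.denseRange_emb μ).induction_on (p := fun v => T.resNeg μ a v - T.resNeg μ b v =
    ((b : ℂ) - a) • T.res a (T.resNeg μ b v)) v (isClosed_eq (by fun_prop) (by fun_prop))
    fun x => ?_
  simp only [ContinuousLinearMap.coe_coe, resNeg_emb]
  exact T.res_sub_res a b x

end C0Semigroup

namespace SystemNode

open HalfLine

variable {U X Y : Type*}
  [NormedAddCommGroup U] [NormedSpace ℂ U]
  [NormedAddCommGroup X] [NormedSpace ℂ X] [CompleteSpace X]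
  [NormedAddCommGroup Y] [NormedSpace ℂ Y]

/-! ### The system node in terms of bounded operators -/

/-- The bounded operator `R(μ, A₋₁) B : U → X`. -/
noncomputable def inOp (S : SystemNode U X Y) : U →L[ℂ] X := (S.T.resNeg S.μ S.μ).comp S.B

/-- The bounded operator `C R(μ, A) : X → Y`. -/
noncomputable def outOp (S : SystemNode U X Y) : X →L[ℂ] Y := S.C.comp (S.T.resX1 S.μ)

/-- The point of the half-plane through which `S.CD` is defined. -/
noncomputable def basePoint (S : SystemNode U X Y) : S.T.halfPlane :=
  ⟨S.T.halfPlane_nonempty.choose, S.T.halfPlane_nonempty.choose_spec⟩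

/-- The bounded operator `u ↦ C&D (R(μ, A₋₁) B u, u)`, the value at `μ` of the transfer function
when `μ` lies in the half-plane. -/
noncomputable def feedOp (S : SystemNode U X Y) : U →L[ℂ] Y :=
  ((S.basePoint : ℂ) - S.μ) •
    S.outOp.comp ((S.T.resNeg S.μ (S.T.toRho S.basePoint)).comp S.B) + S.G S.basePoint

/-- Formally `A x + B u = μ x - (μ - A)(x - inOp u)` and `(μ - A)(x - inOp u) = w`. The identity is
checked after the injective map `R(μ, A₋₁)`. -/
theorem genNeg_add (S : SystemNode U X Y) {x w : X} {u : U}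
    (h : x = S.inOp u + S.T.res S.μ w) :
    S.T.genNeg S.μ x + S.B u = S.T.emb S.μ ((S.μ : ℂ) • x - w) := by
  refine S.T.resNeg_injective S.μ ?_
  rw [map_add, S.T.resNeg_genNeg, S.T.resNeg_emb, map_sub, map_smul]
  have : S.T.resNeg S.μ S.μ (S.B u) = S.inOp u := rfl
  rw [this, eq_sub_of_add_eq h.symm]
  abel

theorem mem_domain_CD (S : SystemNode U X Y) {x w : X} {u : U}
    (h : x = S.inOp u + S.T.res S.μ w) : (x, u) ∈ S.CD.domain :=
  ⟨_, (S.genNeg_add h).symm⟩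

theorem eq_add_res_of_emb_eq (S : SystemNode U X Y) {x v : X} {u : U}
    (h : S.T.emb S.μ v = S.T.genNeg S.μ x + S.B u) :
    x = S.inOp u + S.T.res S.μ ((S.μ : ℂ) • x - v) := by
  have h1 := congrArg (S.T.resNeg S.μ S.μ) h
  rw [map_add, S.T.resNeg_genNeg, S.T.resNeg_emb] at h1
  have : S.T.resNeg S.μ S.μ (S.B u) = S.inOp u := rfl
  rw [map_sub, map_smul, h1, this]
  abel

/-- `C&D` is defined through a base point `β` of the half-plane, whereas `μ` is any point of `ρ(A)`.
The resolvent identity moves `β` to `μ`: it adds `(β - μ) R(β, A₋₁) B u` to `w`, and this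
contribution is collected in `feedOp`. -/
theorem CD_eq (S : SystemNode U X Y) (p : S.CD.domain) {w : X}
    (h : p.1.1 = S.inOp p.1.2 + S.T.res S.μ w) :
    S.CD p = S.outOp w + S.feedOp p.1.2 := by
  refine (S.combinedAt_apply S.basePoint p).trans ?_
  set β := S.T.toRho S.basePoint
  have h1 : p.1.1 - S.T.resNeg S.μ β (S.B p.1.2) =
      S.T.res S.μ (w + ((β : ℂ) - S.μ) • S.T.resNeg S.μ β (S.B p.1.2)) := by
    rw [map_add, map_smul, ← S.T.resNeg_sub_resNeg S.μ S.μ β, h]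
    have : S.T.resNeg S.μ S.μ (S.B p.1.2) = S.inOp p.1.2 := rfl
    rw [this]; abel
  have h2 : S.C (S.T.toX1 S.μ ⟨p.1.1 - S.T.resNeg S.μ β (S.B p.1.2),
        S.T.sub_resNeg_mem S.μ _ p.2⟩) =
      S.outOp (w + ((β : ℂ) - S.μ) • S.T.resNeg S.μ β (S.B p.1.2)) := by
    change _ = S.C (S.T.resX1 S.μ _)
    rw [S.T.resX1_apply]
    congr 2
    exact Subtype.ext h1
  rw [h2, map_add, map_smul, add_assoc]
  rfl

/-! ### Integrated solutions with zero initial value -/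

/-- The state trajectory, seen through `R(μ, A₋₁)`, of the input `h` with zero initial value. -/
noncomputable def resState (S : SystemNode U X Y) (h : ℝ → U) : ℝ → X :=
  S.T.conv fun s => S.inOp (h s)

/-- The second primitive of the state trajectory of the input `h`. -/
noncomputable def state₂ (S : SystemNode U X Y) (h : ℝ → U) : ℝ → X := fun t =>
  -- With `z = resState h` this is `(μ - A₋₁) ∫∫z`, where `A₋₁ ∫∫z = ∫z - inOp ∫∫h`.
  S.inOp (primitive (primitive h) t) +
    ((S.μ : ℂ) • primitive (primitive (S.resState h)) t - primitive (S.resState h) t)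

/-- The element `w` with `state₂ = R(μ, A₋₁) B u₂ + R(μ, A) w`, for the second primitive `u₂`
of the input. -/
noncomputable def aux₂ (S : SystemNode U X Y) (h : ℝ → U) : ℝ → X := fun t =>
  -- This is `(μ - A₋₁)(μ ∫∫z - ∫z)` expanded with `A₋₁ ∫z = z - inOp ∫h` and its primitive.
  -- Equivalently it is `μ x₂ - x₂'` for `x₂ = state₂ h` when `h` is continuous.
  S.resState h t - (2 * (S.μ : ℂ)) • primitive (S.resState h) t +
    ((S.μ : ℂ) * S.μ) • primitive (primitive (S.resState h)) t +
    ((S.μ : ℂ) • S.inOp (primitive (primitive h) t) - S.inOp (primitive h t))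

/-- The second primitive of the output of the input `h`. -/
noncomputable def output₂ (S : SystemNode U X Y) (h : ℝ → U) : ℝ → Y := fun t =>
  S.outOp (S.aux₂ h t) + S.feedOp (primitive (primitive h) t)

variable (S : SystemNode U X Y) {h k : ℝ → U}

theorem locallyIntegrableOn_inOp (hh : LocallyIntegrableOn h (Ici 0)) :
    LocallyIntegrableOn (fun s => S.inOp (h s)) (Ici 0) :=
  locallyIntegrableOn_clm (S.inOp.restrictScalars ℝ) hh

theorem continuousOn_resState (hh : LocallyIntegrableOn h (Ici 0)) :
    ContinuousOn (S.resState h) (Ici 0) :=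
  S.T.continuousOn_conv (S.locallyIntegrableOn_inOp hh)

theorem locallyIntegrableOn_resState (hh : LocallyIntegrableOn h (Ici 0)) :
    LocallyIntegrableOn (S.resState h) (Ici 0) :=
  locallyIntegrableOn_of_continuousOn (S.continuousOn_resState hh)

theorem continuousOn_aux₂ (hh : LocallyIntegrableOn h (Ici 0)) :
    ContinuousOn (S.aux₂ h) (Ici 0) := by
  have h1 := S.continuousOn_resState hh
  have h2 := continuousOn_primitive (S.locallyIntegrableOn_resState hh)
  have h3 := continuousOn_primitive (locallyIntegrableOn_of_continuousOn h2)
  have h4 := continuousOn_primitive hh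
  have h5 := continuousOn_primitive (locallyIntegrableOn_of_continuousOn h4)
  unfold aux₂
  fun_prop

theorem continuousOn_output₂ (hh : LocallyIntegrableOn h (Ici 0)) :
    ContinuousOn (S.output₂ h) (Ici 0) := by
  have h1 := S.continuousOn_aux₂ hh
  have h5 := continuousOn_primitive (locallyIntegrableOn_primitive hh)
  unfold output₂
  fun_prop

theorem resState_sub (hh : LocallyIntegrableOn h (Ici 0)) (hk : LocallyIntegrableOn k (Ici 0))
    {t : ℝ} (ht : 0 ≤ t) :
    S.resState (fun s => h s - k s) t = S.resState h t - S.resState k t := by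
  simp only [resState, map_sub]
  exact S.T.conv_sub (S.locallyIntegrableOn_inOp hh) (S.locallyIntegrableOn_inOp hk) ht

theorem output₂_sub (hh : LocallyIntegrableOn h (Ici 0)) (hk : LocallyIntegrableOn k (Ici 0))
    {t : ℝ} (ht : 0 ≤ t) :
    S.output₂ (fun s => h s - k s) t = S.output₂ h t - S.output₂ k t := by
  have a0 := fun s hs => S.resState_sub hh hk (t := s) hs
  have a1 := fun s hs => primitive_sub_of_eq (S.locallyIntegrableOn_resState hh)
    (S.locallyIntegrableOn_resState hk) a0 (t := s) hs
  have a2 := primitive_sub_of_eq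
    (locallyIntegrableOn_primitive (S.locallyIntegrableOn_resState hh))
    (locallyIntegrableOn_primitive (S.locallyIntegrableOn_resState hk)) a1 ht
  have b1 := fun s hs => primitive_sub hh hk (t := s) hs
  have b2 := primitive_sub_of_eq (locallyIntegrableOn_primitive hh)
    (locallyIntegrableOn_primitive hk) b1 ht
  simp only [output₂, aux₂, a0 t ht, a1 t ht, a2, b1 t ht, b2, map_sub, map_add, map_smul]
  module

/-- No unbounded operator is left in `output₂`, so each term is bounded by the `L¹` norm of the
input on `[0, t]`, with a constant depending on `t` but not on the input. -/
theorem exists_norm_output₂_le {t : ℝ} (ht : 0 ≤ t) :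
    ∃ K : ℝ, ∀ h : ℝ → U, LocallyIntegrableOn h (Ici 0) →
      ‖S.output₂ h t‖ ≤ K * ∫ r in (0 : ℝ)..t, ‖h r‖ := by
  obtain ⟨K, hK0, hK⟩ := S.T.exists_norm_conv_le t
  set m := ‖(S.μ : ℂ)‖
  set b := ‖S.inOp‖
  refine ⟨‖S.outOp‖ * (K * b + 2 * m * (K * b * t) + m * m * (K * b * t * t) +
    (m * (b * t) + b)) + ‖S.feedOp‖ * t, fun h hh => ?_⟩
  set V := ∫ r in (0 : ℝ)..t, ‖h r‖ with hV
  have hhn := (intervalIntegrable hh le_rfl ht).norm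
  have a0 : ∀ s, 0 ≤ s → s ≤ t → ‖S.resState h s‖ ≤ K * b * V := fun s hs hst => by
    refine (hK _ (S.locallyIntegrableOn_inOp hh) s hs hst).trans ?_
    rw [mul_assoc]
    refine mul_le_mul_of_nonneg_left ?_ hK0
    rw [hV, ← intervalIntegral.integral_const_mul]
    exact intervalIntegral.integral_mono_on ht
      (intervalIntegrable (S.locallyIntegrableOn_inOp hh) le_rfl ht).norm (hhn.const_mul b)
      fun r _ => S.inOp.le_opNorm _
  have a1 : ∀ s, 0 ≤ s → s ≤ t → ‖primitive (S.resState h) s‖ ≤ K * b * V * t :=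
    fun s hs hst => norm_primitive_le_of_le a0 hs hst
  have a2 := norm_primitive_le_of_le a1 ht le_rfl
  have b1 : ∀ s, 0 ≤ s → s ≤ t → ‖primitive h s‖ ≤ V := fun s hs hst =>
    norm_primitive_le_integral_norm hh hs hst
  have b2 := norm_primitive_le_of_le b1 ht le_rfl
  have c0 := a0 t ht le_rfl
  have c1 := a1 t ht le_rfl
  have d1 := b1 t ht le_rfl
  have hw : ‖S.aux₂ h t‖ ≤ K * b * V + 2 * m * (K * b * V * t) + m * m * (K * b * V * t * t) +
      (m * (b * (V * t)) + b * V) := by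
    refine (norm_add_le _ _).trans (add_le_add ((norm_add_le _ _).trans (add_le_add
      ((norm_sub_le _ _).trans (add_le_add c0 ?_)) ?_)) ((norm_sub_le _ _).trans (add_le_add ?_ ?_)))
    · rw [norm_smul, norm_mul, Complex.norm_ofNat]
      gcongr
    · rw [norm_smul, norm_mul]
      gcongr
    · rw [norm_smul]
      gcongr
      exact (S.inOp.le_opNorm _).trans (by gcongr)
    · exact (S.inOp.le_opNorm _).trans (by gcongr)
  refine (norm_add_le _ _).trans ((add_le_add ((S.outOp.le_opNorm _).trans
    (mul_le_mul_of_nonneg_left hw (norm_nonneg _))) ((S.feedOp.le_opNorm _).trans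
    (mul_le_mul_of_nonneg_left b2 (norm_nonneg _)))).trans (le_of_eq ?_))
  ring

/-- Together with the variation of constants formula this says `x = (μ - A₋₁) z` for zero initial
value. -/
theorem integral_opNeg (hh : LocallyIntegrableOn h (Ici 0)) {t : ℝ} (ht : 0 ≤ t) :
    ∫ s in (0 : ℝ)..t, S.T.opNeg S.μ (t - s) (S.B (h s)) = S.T.shiftNeg S.μ (S.resState h t) := by
  refine Eq.trans ?_ (((S.T.shiftNeg S.μ).restrictScalars ℝ).intervalIntegral_comp_comm
    (S.T.intervalIntegrable_conv (S.locallyIntegrableOn_inOp hh) ht t))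
  refine intervalIntegral.integral_congr fun s hs => ?_
  rw [uIcc_of_le ht] at hs
  simp only [S.T.opNeg_eq S.μ (sub_nonneg.2 hs.2), max_eq_left (sub_nonneg.2 hs.2)]
  rfl

variable [CompleteSpace U]

theorem res_resState (hh : LocallyIntegrableOn h (Ici 0)) {t : ℝ} (ht : 0 ≤ t) :
    S.T.res S.μ (S.resState h t) - S.T.res S.μ (S.inOp (primitive h t)) =
      (S.μ : ℂ) • S.T.res S.μ (primitive (S.resState h) t) - primitive (S.resState h) t := by
  have h1 := S.T.res_conv S.μ (S.locallyIntegrableOn_inOp hh) ht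
  rwa [show primitive (fun s => S.inOp (h s)) t = S.inOp (primitive h t) from
    primitive_clm (S.inOp.restrictScalars ℝ) hh ht] at h1

theorem resState_primitive (hh : LocallyIntegrableOn h (Ici 0)) {t : ℝ} (ht : 0 ≤ t) :
    S.resState (primitive h) t = primitive (S.resState h) t := by
  refine Eq.trans ?_ (S.T.conv_primitive (S.locallyIntegrableOn_inOp hh) ht)
  exact S.T.conv_congr
    (fun s hs => (primitive_clm (S.inOp.restrictScalars ℝ) hh hs).symm) ht

theorem res_primitive_resState (hh : LocallyIntegrableOn h (Ici 0)) {t : ℝ} (ht : 0 ≤ t) :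
    S.T.res S.μ (primitive (S.resState h) t) - S.T.res S.μ (S.inOp (primitive (primitive h) t)) =
      (S.μ : ℂ) • S.T.res S.μ (primitive (primitive (S.resState h)) t) -
        primitive (primitive (S.resState h)) t := by
  have h1 := S.res_resState (locallyIntegrableOn_primitive hh) ht
  rwa [S.resState_primitive hh ht,
    primitive_congr (fun s hs => S.resState_primitive hh hs) ht] at h1

theorem res_aux₂ (hh : LocallyIntegrableOn h (Ici 0)) {t : ℝ} (ht : 0 ≤ t) :
    S.T.res S.μ (S.aux₂ h t) =
      (S.μ : ℂ) • primitive (primitive (S.resState h)) t - primitive (S.resState h) t := by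
  have h1 := S.res_resState hh ht
  have h2 := S.res_primitive_resState hh ht
  simp only [aux₂, map_add, map_sub, map_smul]
  linear_combination (norm := module) h1 - (S.μ : ℂ) • h2

theorem state₂_eq (hh : LocallyIntegrableOn h (Ici 0)) {t : ℝ} (ht : 0 ≤ t) :
    S.state₂ h t = S.inOp (primitive (primitive h) t) + S.T.res S.μ (S.aux₂ h t) := by
  rw [S.res_aux₂ hh ht, state₂]

theorem res_state₂ (hh : LocallyIntegrableOn h (Ici 0)) {t : ℝ} (ht : 0 ≤ t) :
    S.T.res S.μ (S.state₂ h t) = primitive (primitive (S.resState h)) t := by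
  have h2 := S.res_primitive_resState hh ht
  simp only [state₂, map_add, map_sub, map_smul]
  linear_combination (norm := module) -h2

theorem primitive_aux₂ (hh : LocallyIntegrableOn h (Ici 0)) {t : ℝ} (ht : 0 ≤ t) :
    S.aux₂ (primitive h) t = primitive (S.aux₂ h) t := by
  have a0 := fun s hs => S.resState_primitive hh (t := s) hs
  have a1 : ∀ s ∈ Ici (0 : ℝ), primitive (S.resState (primitive h)) s =
      primitive (primitive (S.resState h)) s := primitive_congr a0
  have a2 : ∀ s ∈ Ici (0 : ℝ), primitive (primitive (S.resState (primitive h))) s =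
      primitive (primitive (primitive (S.resState h))) s := primitive_congr a1
  have h1 := S.continuousOn_resState hh
  have h2 := continuousOn_primitive (locallyIntegrableOn_of_continuousOn h1)
  have h3 := continuousOn_primitive (locallyIntegrableOn_of_continuousOn h2)
  have h4 := continuousOn_primitive hh
  have h5 := continuousOn_primitive (locallyIntegrableOn_of_continuousOn h4)
  have e4 := primitive_clm (S.inOp.restrictScalars ℝ) (locallyIntegrableOn_of_continuousOn h4) ht
  have e5 := primitive_clm (S.inOp.restrictScalars ℝ) (locallyIntegrableOn_of_continuousOn h5) ht
  simp only [ContinuousLinearMap.coe_restrictScalars'] at e4 e5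
  unfold aux₂
  rw [a0 t ht, a1 t ht, a2 t ht,
    primitive_add (locallyIntegrableOn_of_continuousOn (by fun_prop))
      (locallyIntegrableOn_of_continuousOn (by fun_prop)) ht,
    primitive_add (locallyIntegrableOn_of_continuousOn (by fun_prop))
      (locallyIntegrableOn_of_continuousOn (by fun_prop)) ht,
    primitive_sub (locallyIntegrableOn_of_continuousOn (by fun_prop))
      (locallyIntegrableOn_of_continuousOn (by fun_prop)) ht,
    primitive_sub (locallyIntegrableOn_of_continuousOn (by fun_prop))
      (locallyIntegrableOn_of_continuousOn (by fun_prop)) ht,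
    primitive_smul, primitive_smul, primitive_smul, e4, e5]

/-- Time invariance: `output₂` is built from convolution with the semigroup, primitives and constant
bounded operators, and each commutes with integration from `0`. -/
theorem output₂_primitive [CompleteSpace Y] (hh : LocallyIntegrableOn h (Ici 0)) {t : ℝ}
    (ht : 0 ≤ t) : S.output₂ (primitive h) t = primitive (S.output₂ h) t := by
  have h1 := S.continuousOn_aux₂ hh
  have h5 := continuousOn_primitive (locallyIntegrableOn_primitive hh)
  have e1 := primitive_clm (S.outOp.restrictScalars ℝ) (locallyIntegrableOn_of_continuousOn h1) ht
  have e5 := primitive_clm (S.feedOp.restrictScalars ℝ) (locallyIntegrableOn_of_continuousOn h5) ht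
  simp only [ContinuousLinearMap.coe_restrictScalars'] at e1 e5
  unfold output₂
  rw [primitive_add (locallyIntegrableOn_of_continuousOn (by fun_prop))
      (locallyIntegrableOn_of_continuousOn (by fun_prop)) ht, e1, e5, S.primitive_aux₂ hh ht]

theorem output₂_primitive_primitive [CompleteSpace Y] (hh : LocallyIntegrableOn h (Ici 0)) {t : ℝ}
    (ht : 0 ≤ t) :
    S.output₂ (primitive (primitive h)) t = primitive (primitive (S.output₂ h)) t := by
  rw [S.output₂_primitive (locallyIntegrableOn_primitive hh) ht]
  exact primitive_congr (fun s hs => S.output₂_primitive hh hs) ht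

/-! ### Generalised solutions -/

/-- The embedding of `X` into `X₋₁` is injective, so the twice integrated state is `state₂ h`. Any
admissible `f` in the definition then equals `output₂ h` on `[0, ∞)`. -/
theorem output₂_of_isGeneralisedSolution [CompleteSpace Y] {x : ℝ → S.T.Xneg S.μ}
    {y : 𝓓'((⊤ : TopologicalSpace.Opens ℝ), Y)} (hs : S.IsGeneralisedSolution 0 h x y) :
    y = ∂_{(1 : ℝ)} (∂_{(1 : ℝ)} (distOf (S.output₂ h))) := by
  obtain ⟨hh, -, hx, f, hf, rfl⟩ := hs
  have hJ : ∀ {g : ℝ → X}, LocallyIntegrableOn g (Ici 0) → ∀ {t : ℝ}, 0 ≤ t →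
      primitive (fun s => S.T.shiftNeg S.μ (g s)) t = S.T.shiftNeg S.μ (primitive g t) :=
    fun hg _ ht => primitive_clm ((S.T.shiftNeg S.μ).restrictScalars ℝ) hg ht
  have hz := S.locallyIntegrableOn_resState hh
  have hx' : EqOn x (fun t => S.T.shiftNeg S.μ (S.resState h t)) (Ici 0) := fun t ht => by
    rw [hx t ht, map_zero, map_zero, zero_add, S.integral_opNeg hh ht]
  have hxi : LocallyIntegrableOn x (Ici 0) := locallyIntegrableOn_congr
    (locallyIntegrableOn_clm ((S.T.shiftNeg S.μ).restrictScalars ℝ) hz) hx'.symm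
  refine congrArg _ (congrArg _ (distOf_congr
    (locallyIntegrableOn_of_continuousOn (S.continuousOn_output₂ hh)) ?_).symm)
  intro t ht
  obtain ⟨p, hp1, hp2, hp3⟩ := hf t ht
  rw [← primitive_primitive hxi ht, primitive_congr (primitive_congr hx') ht,
    primitive_congr (fun s hs => hJ hz hs) ht, hJ (locallyIntegrableOn_primitive hz) ht,
    ← S.res_state₂ hh ht, S.T.shiftNeg_res] at hp1
  rw [← primitive_primitive hh ht] at hp2
  have hp1 := S.T.emb_injective S.μ hp1
  rw [hp3, S.CD_eq p (w := S.aux₂ h t) (by rw [hp1, hp2, S.state₂_eq hh ht]), hp2, output₂]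

end SystemNode

namespace SystemNode

open HalfLine

variable {U X Y : Type*}
  [NormedAddCommGroup U] [NormedSpace ℂ U] [CompleteSpace U]
  [NormedAddCommGroup X] [NormedSpace ℂ X] [CompleteSpace X]
  [NormedAddCommGroup Y] [NormedSpace ℂ Y]

variable (S : SystemNode U X Y)

/-! ### Classical solutions -/

/-- For a twice integrated continuous input, the twice integrated trajectories form a classical
solution. -/
theorem isClassicalSolution_state₂ {u φ : ℝ → U} (hφ : ContinuousOn φ (Ici 0))
    (e : EqOn u (primitive (primitive φ)) (Ici 0)) :
    S.IsClassicalSolution u (S.state₂ φ) (S.output₂ φ) := by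
  have hh := locallyIntegrableOn_of_continuousOn hφ
  have c1 := continuousOn_primitive hh
  have c2 := continuousOn_primitive (locallyIntegrableOn_of_continuousOn c1)
  have z0 := S.continuousOn_resState hh
  have z1 := continuousOn_primitive (locallyIntegrableOn_of_continuousOn z0)
  have z2 := continuousOn_primitive (locallyIntegrableOn_of_continuousOn z1)
  -- By `genNeg_add` this derivative is `A x + B u`, with `aux₂ φ` in the role of `w`.
  have hd : ∀ t, 0 ≤ t → HasDerivWithinAt (S.state₂ φ)
      ((S.μ : ℂ) • S.state₂ φ t - S.aux₂ φ t) (Ici 0) t := fun t ht => by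
    have d1 := (S.inOp.restrictScalars ℝ).hasFDerivAt.comp_hasDerivWithinAt t
      (HalfLine.hasDerivWithinAt_primitive c1 ht)
    have d2 := ((HalfLine.hasDerivWithinAt_primitive z1 ht).const_smul (S.μ : ℂ)).sub
      (HalfLine.hasDerivWithinAt_primitive z0 ht)
    refine (d1.add d2).congr_deriv ?_
    simp only [state₂, aux₂, ContinuousLinearMap.coe_restrictScalars']
    module
  have hder : ∀ t ∈ Ici (0 : ℝ), derivWithin (S.state₂ φ) (Ici 0) t =
      (S.μ : ℂ) • S.state₂ φ t - S.aux₂ φ t := fun t ht =>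
    (hd t ht).derivWithin (uniqueDiffOn_Ici 0 t ht)
  have hsc : ContinuousOn (S.state₂ φ) (Ici 0) := fun t ht => (hd t ht).continuousWithinAt
  have hac := S.continuousOn_aux₂ hh
  refine ⟨c2.congr e, ?_, S.continuousOn_output₂ hh, fun t ht => ?_⟩
  · rw [contDiffOn_one_iff_derivWithin (uniqueDiffOn_Ici 0)]
    exact ⟨fun t ht => (hd t ht).differentiableWithinAt,
      ContinuousOn.congr (by fun_prop) hder⟩
  · have h1 : S.state₂ φ t = S.inOp (u t) + S.T.res S.μ (S.aux₂ φ t) := by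
      rw [S.state₂_eq hh ht, e ht]
    refine ⟨S.mem_domain_CD h1, ?_, ?_⟩
    · rw [hder t ht, S.genNeg_add h1]
    · rw [S.CD_eq ⟨_, _⟩ h1, output₂, ← e ht]

/-- A classical solution with zero initial value is a generalised solution. -/
theorem IsClassicalSolution.isGeneralisedSolution [CompleteSpace Y] {S : SystemNode U X Y}
    {u : ℝ → U} {x : ℝ → X} {y : ℝ → Y} (hs : S.IsClassicalSolution u x y) (hx0 : x 0 = 0) :
    S.IsGeneralisedSolution 0 u (fun t => S.T.emb S.μ (x t)) (distOf y) := by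
  obtain ⟨hu, hx, hy, hxy⟩ := hs
  set x' := derivWithin x (Ici 0) with hx'
  have hxd : ∀ t, 0 ≤ t → HasDerivWithinAt x (x' t) (Ici 0) t := fun t ht =>
    ((hx.differentiableOn (by simp)) t ht).hasDerivWithinAt
  have hxc := hx.continuousOn
  have hx'c : ContinuousOn x' (Ici 0) := hx.continuousOn_derivWithin (uniqueDiffOn_Ici 0) (by simp)
  have lu := locallyIntegrableOn_of_continuousOn hu
  have lx := locallyIntegrableOn_of_continuousOn hxc
  have lx' := locallyIntegrableOn_of_continuousOn hx'c
  have hxp : EqOn (primitive x') x (Ici 0) := fun t ht => by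
    rw [primitive_deriv hxd hx'c ht, hx0, sub_zero]
  set w : ℝ → X := fun t => (S.μ : ℂ) • x t - x' t with hw
  have hwc : ContinuousOn w (Ici 0) := by fun_prop
  have lw := locallyIntegrableOn_of_continuousOn hwc
  have hxw : ∀ t, 0 ≤ t → x t = S.inOp (u t) + S.T.res S.μ (w t) := fun t ht => by
    obtain ⟨-, h1, -⟩ := hxy t ht
    exact S.eq_add_res_of_emb_eq h1
  have hyw : ∀ t, 0 ≤ t → y t = S.outOp (w t) + S.feedOp (u t) := fun t ht => by
    obtain ⟨hm, -, h2⟩ := hxy t ht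
    rw [h2, S.CD_eq ⟨_, hm⟩ (hxw t ht)]
  -- This is the variation of constants formula seen through `R(μ, A)`. It comes from `res_conv`
  -- applied to `x'`, whose primitive is `x` because `x 0 = 0`, and from `inOp u = x - R(μ, A) w`
  -- with `w = μ x - x'`.
  have hz : ∀ t, 0 ≤ t → S.T.res S.μ (x t) = S.resState u t := fun t ht => by
    have r1 := S.T.res_conv S.μ lx' ht
    have r2 : primitive (S.T.conv x') t = S.T.conv x t := by
      rw [← S.T.conv_primitive lx' ht, S.T.conv_congr hxp ht]
    rw [r2, hxp ht] at r1
    have r3 : S.resState u t = S.T.conv x t - S.T.res S.μ (S.T.conv w t) := by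
      have lR := locallyIntegrableOn_clm ((S.T.res S.μ).restrictScalars ℝ) lw
      rw [← S.T.conv_clm _ (fun t ht => S.T.res_op_comm S.μ ht) lw ht]
      refine Eq.trans ?_ (S.T.conv_sub lx lR ht)
      exact S.T.conv_congr (fun s hs => by rw [hxw s hs]; simp) ht
    have r4 : S.T.conv w t = (S.μ : ℂ) • S.T.conv x t - S.T.conv x' t := by
      have lm := locallyIntegrableOn_clm
        (((S.μ : ℂ) • ContinuousLinearMap.id ℂ X).restrictScalars ℝ) lx
      have m1 := S.T.conv_clm ((S.μ : ℂ) • ContinuousLinearMap.id ℂ X)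
        (fun t _ x => by simp) lx ht
      exact (S.T.conv_sub lm lx' ht).trans (by rw [sub_left_inj]; exact m1)
    rw [r3, r4, map_sub, map_smul]
    linear_combination (norm := module) -r1
  -- The double primitive of `y` serves as the function `f` of the definition. That it equals `C&D`
  -- of the integrated pair follows by integrating `hxw` and `hyw` twice.
  have hdist : distOf y = ∂_{(1 : ℝ)} (∂_{(1 : ℝ)} (distOf (primitive (primitive y)))) := by
    have ly := locallyIntegrableOn_of_continuousOn hy
    rw [lineDeriv_distOf_primitive (locallyIntegrableOn_primitive ly),
      lineDeriv_distOf_primitive ly]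
  refine ⟨lu, (S.T.emb S.μ).continuous.comp_continuousOn hxc, fun t ht => ?_,
    primitive (primitive y), fun t ht => ?_, hdist⟩
  · simp only [map_zero, zero_add]
    rw [S.integral_opNeg lu ht, ← hz t ht, S.T.shiftNeg_res]
  · have px := primitive_clm_add (S.inOp.restrictScalars ℝ) ((S.T.res S.μ).restrictScalars ℝ)
      (locallyIntegrableOn_primitive lu) (locallyIntegrableOn_primitive lw)
      (primitive_clm_add (S.inOp.restrictScalars ℝ) ((S.T.res S.μ).restrictScalars ℝ) lu lw hxw)
      t ht
    have py := primitive_clm_add (S.outOp.restrictScalars ℝ) (S.feedOp.restrictScalars ℝ)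
      (locallyIntegrableOn_primitive lw) (locallyIntegrableOn_primitive lu)
      (primitive_clm_add (S.outOp.restrictScalars ℝ) (S.feedOp.restrictScalars ℝ) lw lu hyw)
      t ht
    refine ⟨⟨_, S.mem_domain_CD px⟩, ?_, primitive_primitive lu ht, ?_⟩
    · have le := locallyIntegrableOn_clm ((S.T.emb S.μ).restrictScalars ℝ) lx
      refine Eq.trans ?_ (primitive_primitive le ht)
      rw [primitive_congr (fun s hs => primitive_clm ((S.T.emb S.μ).restrictScalars ℝ) lx hs) ht]
      exact (primitive_clm ((S.T.emb S.μ).restrictScalars ℝ)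
        (locallyIntegrableOn_primitive lx) ht).symm
    · rw [S.CD_eq ⟨_, S.mem_domain_CD px⟩ px]
      exact py

end SystemNode

namespace HalfLine

/-! ### Local `L¹` convergence on the half-line -/

section

variable {E : Type*} [NormedAddCommGroup E]

theorem integral_norm_mono {h : ℝ → E} (hh : LocallyIntegrableOn h (Ici 0)) {s t : ℝ}
    (hs : 0 ≤ s) (hst : s ≤ t) : ∫ r in (0 : ℝ)..s, ‖h r‖ ≤ ∫ r in (0 : ℝ)..t, ‖h r‖ :=
  intervalIntegral.integral_mono_interval le_rfl hs hst
    (Eventually.of_forall fun _ => norm_nonneg _) (intervalIntegrable hh le_rfl (hs.trans hst)).norm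

theorem integral_norm_le_add {f g h : ℝ → E} (hf : LocallyIntegrableOn f (Ici 0))
    (hg : LocallyIntegrableOn g (Ici 0)) (hh : LocallyIntegrableOn h (Ici 0))
    (hle : ∀ s, ‖f s‖ ≤ ‖g s‖ + ‖h s‖) {t : ℝ} (ht : 0 ≤ t) :
    ∫ s in (0 : ℝ)..t, ‖f s‖ ≤ (∫ s in (0 : ℝ)..t, ‖g s‖) + ∫ s in (0 : ℝ)..t, ‖h s‖ := by
  have ig := (intervalIntegrable hg le_rfl ht).norm
  have ih := (intervalIntegrable hh le_rfl ht).norm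
  rw [← intervalIntegral.integral_add ig ih]
  exact intervalIntegral.integral_mono_on ht (intervalIntegrable hf le_rfl ht).norm (ig.add ih)
    fun s _ => hle s

theorem ofReal_integral_norm {h : ℝ → E} (hh : LocallyIntegrableOn h (Ici 0)) {t : ℝ}
    (ht : 0 ≤ t) :
    ENNReal.ofReal (∫ s in (0 : ℝ)..t, ‖h s‖) = eLpNorm h 1 (volume.restrict (Ioc 0 t)) := by
  rw [intervalIntegral.integral_of_le ht, eLpNorm_one_eq_lintegral_enorm,
    ofReal_integral_norm_eq_lintegral_enorm
      ((intervalIntegrable_iff_integrableOn_Ioc_of_le ht).1 (intervalIntegrable hh le_rfl ht))]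

/-- Completeness of `L¹_loc([0, ∞), E)`. -/
theorem exists_tendsto_of_cauchy [CompleteSpace E] {f : ℕ → ℝ → E}
    (hf : ∀ n, LocallyIntegrableOn (f n) (Ici 0)) {c : ℝ}
    (hc : ∀ k n m : ℕ, k ≤ n → k ≤ m →
      ∫ s in (0 : ℝ)..k, ‖f n s - f m s‖ ≤ c * (1 / 2) ^ k) :
    ∃ g : ℝ → E, LocallyIntegrableOn g (Ici 0) ∧
      ∀ t, 0 ≤ t → Tendsto (fun n => ∫ s in (0 : ℝ)..t, ‖f n s - g s‖) atTop (𝓝 0) := by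
  -- The constant `|c| + 1` is positive whatever the sign of `c` and makes the Cauchy estimate
  -- strict. On `(0, k]` the sequence is shifted by `k`, where the hypothesis becomes effective.
  set B : ℕ → ENNReal := fun N => ENNReal.ofReal ((|c| + 1) * (1 / 2) ^ N) with hB
  have hBs : ∑' i, B i ≠ ⊤ := by
    have : Summable fun N : ℕ => (|c| + 1) * (1 / 2 : ℝ) ^ N :=
      summable_geometric_two.mul_left _
    exact this.tsum_ofReal_ne_top
  have hcau : ∀ k N n m : ℕ, N ≤ n → N ≤ m →
      eLpNorm (f (n + k) - f (m + k)) 1 (volume.restrict (Ioc (0 : ℝ) k)) < B N := by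
    intro k N n m hn hm
    have hk0 : (0 : ℝ) ≤ k := Nat.cast_nonneg k
    have hl := (hf (n + k)).sub (hf (m + k))
    rw [← ofReal_integral_norm hl hk0]
    refine (ENNReal.ofReal_lt_ofReal_iff (by positivity)).2 ?_
    have h1 := (integral_norm_mono hl hk0 (by simp : (k : ℝ) ≤ (N + k : ℕ))).trans
      (hc (N + k) (n + k) (m + k) (by lia) (by lia))
    refine h1.trans_lt ?_
    have h2 : (1 / 2 : ℝ) ^ (N + k) ≤ (1 / 2) ^ N :=
      pow_le_pow_of_le_one (by norm_num) (by norm_num) (by lia)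
    have h3 : (0 : ℝ) < (1 / 2) ^ N := by positivity
    have h4 : (0 : ℝ) < (1 / 2) ^ (N + k) := by positivity
    calc c * (1 / 2) ^ (N + k) ≤ |c| * (1 / 2) ^ (N + k) :=
          mul_le_mul_of_nonneg_right (le_abs_self c) h4.le
      _ ≤ |c| * (1 / 2) ^ N := mul_le_mul_of_nonneg_left h2 (abs_nonneg c)
      _ < (|c| + 1) * (1 / 2) ^ N := mul_lt_mul_of_pos_right (lt_add_one _) h3
  have hm : ∀ k n : ℕ, AEStronglyMeasurable (f n) (volume.restrict (Ioc (0 : ℝ) k)) := fun k n =>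
    ((intervalIntegrable_iff_integrableOn_Ioc_of_le (Nat.cast_nonneg k)).1
      (intervalIntegrable (hf n) le_rfl (Nat.cast_nonneg k))).aestronglyMeasurable
  -- A pointwise limit gives one function that serves for all intervals `(0, k]` at once.
  set g : ℝ → E := fun s => limUnder atTop fun n => f n s with hg
  have hlim : ∀ k : ℕ, ∀ᵐ s ∂(volume.restrict (Ioc (0 : ℝ) k)),
      Tendsto (fun n => f n s) atTop (𝓝 (g s)) := by
    intro k
    filter_upwards [Lp.ae_tendsto_of_cauchy_eLpNorm (fun n => hm k (n + k)) le_rfl hBs (hcau k)]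
      with s hs
    obtain ⟨l, hl⟩ := hs
    exact tendsto_nhds_limUnder ⟨l, (tendsto_add_atTop_iff_nat k).1 hl⟩
  have hL : ∀ k : ℕ, Tendsto (fun n => eLpNorm (f n - g) 1 (volume.restrict (Ioc (0 : ℝ) k)))
      atTop (𝓝 0) := fun k =>
    (tendsto_add_atTop_iff_nat k).1 (Lp.cauchy_tendsto_of_tendsto (fun n => hm k (n + k)) g hBs
      (hcau k) ((hlim k).mono fun s hs => (tendsto_add_atTop_iff_nat k).2 hs))
  have hgi : ∀ k : ℕ, Integrable g (volume.restrict (Ioc (0 : ℝ) k)) := by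
    intro k
    have hgm : AEStronglyMeasurable g (volume.restrict (Ioc (0 : ℝ) k)) :=
      aestronglyMeasurable_of_tendsto_ae atTop (hm k) (hlim k)
    obtain ⟨n, hn⟩ := ((hL k).eventually (gt_mem_nhds one_pos)).exists
    have h1 : Integrable (f n - g) (volume.restrict (Ioc (0 : ℝ) k)) :=
      memLp_one_iff_integrable.1 ⟨(hm k n).sub hgm, hn.trans ENNReal.one_lt_top⟩
    have h2 : Integrable (f n) (volume.restrict (Ioc (0 : ℝ) k)) :=
      (intervalIntegrable_iff_integrableOn_Ioc_of_le (Nat.cast_nonneg k)).1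
        (intervalIntegrable (hf n) le_rfl (Nat.cast_nonneg k))
    simpa using h2.sub h1
  have hgl : LocallyIntegrableOn g (Ici 0) :=
    locallyIntegrableOn_of_intervalIntegrable fun t ht => by
      obtain ⟨k, hk⟩ := exists_nat_ge t
      rw [intervalIntegrable_iff_integrableOn_Ioc_of_le ht]
      exact IntegrableOn.mono_set (hgi k) (Ioc_subset_Ioc_right hk)
  refine ⟨g, hgl, fun t ht => ?_⟩
  obtain ⟨k, hk⟩ := exists_nat_ge t
  have hk0 : (0 : ℝ) ≤ k := Nat.cast_nonneg k
  have hr := (ENNReal.tendsto_toReal ENNReal.zero_ne_top).comp (hL k)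
  refine squeeze_zero (fun n => intervalIntegral.integral_nonneg ht fun _ _ => norm_nonneg _)
    (fun n => ?_) hr
  refine (integral_norm_mono ((hf n).sub hgl) ht hk).trans (le_of_eq ?_)
  simp only [Function.comp_apply]
  rw [← ofReal_integral_norm ((hf n).sub hgl) hk0, ENNReal.toReal_ofReal
    (intervalIntegral.integral_nonneg hk0 fun _ _ => norm_nonneg _)]

end

/-- Locally integrable functions on the half-line are approximated in `L¹([0, t])` by functions in
`C_c^∞((0, ∞))`. -/
theorem exists_contDiff_integral_norm_sub_le {E : Type*} [NormedAddCommGroup E] [NormedSpace ℝ E]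
    {u : ℝ → E} (hu : LocallyIntegrableOn u (Ici 0)) {t : ℝ} (ht : 0 ≤ t) {ε : ℝ} (hε : 0 < ε) :
    ∃ v : ℝ → E, ContDiff ℝ ∞ v ∧ HasCompactSupport v ∧ tsupport v ⊆ Ioi 0 ∧
      ∫ s in (0 : ℝ)..t, ‖u s - v s‖ ≤ ε := by
  -- The part of `u` near `0` has small mass and is discarded, leaving room for a cutoff vanishing
  -- near `0`.
  obtain ⟨δ, hδ, hδu⟩ : ∃ δ : ℝ, 0 < δ ∧ ∫ s in (0 : ℝ)..δ, ‖u s‖ ≤ ε / 2 := by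
    have hc := continuousOn_primitive (h := fun s => ‖u s‖)
      (locallyIntegrableOn_of_intervalIntegrable fun t ht => (intervalIntegrable hu le_rfl ht).norm)
      0 self_mem_Ici
    have h1 : Tendsto (primitive fun s => ‖u s‖) (𝓝[>] 0) (𝓝 0) := by
      simpa using hc.tendsto.mono_left (nhdsWithin_mono _ Ioi_subset_Ici_self)
    obtain ⟨δ, h2, h3⟩ := ((h1.eventually (gt_mem_nhds (half_pos hε))).and
      self_mem_nhdsWithin).exists
    exact ⟨δ, h3, h2.le⟩
  have hui : IntegrableOn u (Ioc 0 t) :=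
    (intervalIntegrable_iff_integrableOn_Ioc_of_le ht).1 (intervalIntegrable hu le_rfl ht)
  set f : ℝ → E := (Ioc δ t).indicator u with hf
  have hfi : Integrable f :=
    (integrable_indicator_iff measurableSet_Ioc).2 (hui.mono_set (Ioc_subset_Ioc_left hδ.le))
  obtain ⟨w, hwc, hws, hwe⟩ := (memLp_one_iff_integrable.2 hfi).exist_eLpNorm_sub_le (by simp)
    le_rfl (half_pos hε)
  have hwi : Integrable w := hws.continuous.integrable_of_hasCompactSupport hwc
  have hfw : ∫ s, ‖f s - w s‖ ≤ ε / 2 := by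
    rw [eLpNorm_one_eq_lintegral_enorm, ← ofReal_integral_norm_eq_lintegral_enorm (hfi.sub hwi)]
      at hwe
    exact (ENNReal.ofReal_le_ofReal_iff (half_pos hε).le).1 hwe
  -- The smooth cutoff is `0` up to `δ / 2` and `1` from `δ` on. On `(0, δ]` the truncation `f`
  -- vanishes, so `‖w‖ = ‖f - w‖` and the error is at most `‖u‖ + ‖f - w‖`.
  set χ : ℝ → ℝ := fun s => Real.smoothTransition ((s - δ / 2) / (δ / 2)) with hχ
  have hχs : ContDiff ℝ ∞ χ := Real.smoothTransition.contDiff.comp (by fun_prop)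
  have hχ1 : ∀ s, δ ≤ s → χ s = 1 := fun s hs =>
    Real.smoothTransition.one_of_one_le (by rw [le_div_iff₀ (half_pos hδ)]; linarith)
  have hχ0 : ∀ s, s ≤ δ / 2 → χ s = 0 := fun s hs =>
    Real.smoothTransition.zero_of_nonpos
      (div_nonpos_of_nonpos_of_nonneg (by linarith) (half_pos hδ).le)
  have hvs : ContDiff ℝ ∞ fun s => χ s • w s := hχs.smul hws
  refine ⟨fun s => χ s • w s, hvs, hwc.smul_left, ?_, ?_⟩
  · have : tsupport (fun s => χ s • w s) ⊆ Ici (δ / 2) := by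
      refine closure_minimal (fun s hs => ?_) isClosed_Ici
      by_contra hn
      exact hs (by simp [hχ0 s (le_of_lt (not_le.1 hn))])
    exact this.trans fun s hs => lt_of_lt_of_le (half_pos hδ) hs
  · have i1 : IntegrableOn (fun s => (Iic δ).indicator (fun s => ‖u s‖) s) (Ioc 0 t) :=
      Integrable.indicator hui.norm measurableSet_Iic
    have i2 : IntegrableOn (fun s => ‖f s - w s‖) (Ioc 0 t) := (hfi.sub hwi).norm.integrableOn
    have i3 : IntegrableOn (fun s => ‖u s - χ s • w s‖) (Ioc 0 t) :=
      (hui.sub (hvs.continuous.integrable_of_hasCompactSupport hwc.smul_left).integrableOn).norm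
    rw [intervalIntegral.integral_of_le ht]
    calc ∫ s in Ioc 0 t, ‖u s - χ s • w s‖
        ≤ ∫ s in Ioc 0 t, ((Iic δ).indicator (fun s => ‖u s‖) s + ‖f s - w s‖) := by
          refine setIntegral_mono_on i3 (i1.add i2) measurableSet_Ioc fun s hs => ?_
          rcases le_or_gt s δ with h | h
          · have e1 : f s = 0 := indicator_of_notMem (fun hm => not_lt.2 h hm.1) _
            rw [indicator_of_mem (mem_Iic.2 h), e1, zero_sub, norm_neg]
            refine (norm_sub_le _ _).trans (add_le_add_right ?_ _)
            rw [norm_smul, Real.norm_of_nonneg (Real.smoothTransition.nonneg _)]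
            exact mul_le_of_le_one_left (norm_nonneg _) (Real.smoothTransition.le_one _)
          · have e1 : f s = u s := indicator_of_mem (show s ∈ Ioc δ t from ⟨h, hs.2⟩) _
            rw [indicator_of_notMem (fun hm => not_lt.2 (mem_Iic.1 hm) h), e1, hχ1 s h.le, one_smul,
              zero_add]
      _ = (∫ s in Ioc 0 t, (Iic δ).indicator (fun s => ‖u s‖) s) +
            ∫ s in Ioc 0 t, ‖f s - w s‖ := integral_add i1 i2
      _ ≤ ε / 2 + ε / 2 := by
          refine add_le_add ?_ ?_
          · rw [setIntegral_indicator measurableSet_Iic]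
            rw [intervalIntegral.integral_of_le hδ.le] at hδu
            refine (setIntegral_mono_set
              ((intervalIntegrable_iff_integrableOn_Ioc_of_le hδ.le).1
                (intervalIntegrable hu le_rfl hδ.le)).norm
              (Eventually.of_forall fun _ => norm_nonneg _)
              (Eventually.of_forall fun s hs => ⟨hs.1.1, hs.2⟩)).trans hδu
          · exact (setIntegral_le_integral (hfi.sub hwi).norm
              (Eventually.of_forall fun _ => norm_nonneg _)).trans hfw
      _ = ε := add_halves ε

/-- A smooth function vanishing near `0` is the second primitive of its second derivative. -/
theorem eqOn_primitive_primitive {E : Type*} [NormedAddCommGroup E] [NormedSpace ℝ E]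
    [CompleteSpace E] {u : ℝ → E} (hu : ContDiff ℝ ∞ u) (hs : tsupport u ⊆ Ioi 0) :
    EqOn u (primitive (primitive (deriv (deriv u)))) (Ici 0) := by
  have h1 : ContDiff ℝ ∞ (deriv u) := (contDiff_infty_iff_deriv.1 hu).2
  have h2 : ContDiff ℝ ∞ (deriv (deriv u)) := (contDiff_infty_iff_deriv.1 h1).2
  have h0 : (0 : ℝ) ∉ tsupport u := fun h => lt_irrefl (0 : ℝ) (mem_Ioi.1 (hs h))
  have z0 : u 0 = 0 := image_eq_zero_of_notMem_tsupport h0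
  have z1 : deriv u 0 = 0 := Function.notMem_support.1 fun h => h0 (support_deriv_subset h)
  have p1 : EqOn (primitive (deriv (deriv u))) (deriv u) (Ici 0) := fun t ht => by
    rw [primitive_deriv (fun s _ => ((h1.differentiable (by simp)) s).hasDerivAt.hasDerivWithinAt)
      h2.continuous.continuousOn ht, z1, sub_zero]
  intro t ht
  rw [primitive_congr p1 ht,
    primitive_deriv (fun s _ => ((hu.differentiable (by simp)) s).hasDerivAt.hasDerivWithinAt)
      h1.continuous.continuousOn ht, z0, sub_zero]

end HalfLine

/-! ### Equivalence of the two stability notions. -/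

namespace SystemNode

open HalfLine

variable {U X Y : Type*}
  [NormedAddCommGroup U] [NormedSpace ℂ U] [CompleteSpace U]
  [NormedAddCommGroup X] [NormedSpace ℂ X] [CompleteSpace X]
  [NormedAddCommGroup Y] [NormedSpace ℂ Y] [CompleteSpace Y]

theorem IsL1LILOStable.isSmoothLILOStable {S : SystemNode U X Y} (hS : S.IsL1LILOStable) :
    S.IsSmoothLILOStable := by
  obtain ⟨c, hc0, hc⟩ := hS
  refine ⟨c, hc0, fun u x y hs _ _ _ hx0 => ?_⟩
  have ly := locallyIntegrableOn_of_continuousOn hs.2.2.1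
  obtain ⟨g, lg, hyg, hg⟩ := hc u _ _ (hs.isGeneralisedSolution hx0)
  refine ⟨ly, fun t ht => (le_of_eq ?_).trans (hg t ht)⟩
  have hae := ae_eq_of_distOf_eq ly lg hyg
  rw [intervalIntegral.integral_of_le ht.le, intervalIntegral.integral_of_le ht.le]
  refine integral_congr_ae ?_
  filter_upwards [ae_restrict_of_ae_restrict_of_subset
    (fun s hs => le_of_lt hs.1 : Ioc (0 : ℝ) t ⊆ Ici 0) hae] with s hs
  rw [hs]

theorem IsSmoothLILOStable.isL1LILOStable {S : SystemNode U X Y} (hS : S.IsSmoothLILOStable) :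
    S.IsL1LILOStable := by
  obtain ⟨c, hc0, hc⟩ := hS
  refine ⟨c, hc0, fun u x y hs => ?_⟩
  have lu := hs.1
  -- `v n` approximates `u` on `[0, n]` with error `(1/2) ^ n`: a growing interval and a summable
  -- error, as `exists_tendsto_of_cauchy` requires.
  choose v hv hvc hvs hve using fun n : ℕ =>
    exists_contDiff_integral_norm_sub_le lu (Nat.cast_nonneg (α := ℝ) n)
      (pow_pos (one_half_pos (α := ℝ)) n)
  have lv : ∀ n, LocallyIntegrableOn (v n) (Ici 0) := fun n =>
    locallyIntegrableOn_of_continuousOn (hv n).continuous.continuousOn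
  set φ : ℕ → ℝ → U := fun n => deriv (deriv (v n)) with hφ
  have cφ : ∀ n, ContinuousOn (φ n) (Ici 0) := fun n =>
    (contDiff_infty_iff_deriv.1 (contDiff_infty_iff_deriv.1 (hv n)).2).2.continuous.continuousOn
  have lφ : ∀ n, LocallyIntegrableOn (φ n) (Ici 0) := fun n =>
    locallyIntegrableOn_of_continuousOn (cφ n)
  have hvφ : ∀ n, EqOn (v n) (primitive (primitive (φ n))) (Ici 0) := fun n =>
    eqOn_primitive_primitive (hv n) (hvs n)
  have ly : ∀ n, LocallyIntegrableOn (S.output₂ (φ n)) (Ici 0) := fun n =>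
    locallyIntegrableOn_of_continuousOn (S.continuousOn_output₂ (lφ n))
  have z0 : ∀ ψ : ℝ → U, S.state₂ ψ 0 = 0 := fun ψ => by simp [state₂]
  have bound : ∀ n t, 0 < t →
      ∫ s in (0 : ℝ)..t, ‖S.output₂ (φ n) s‖ ≤ c * ∫ s in (0 : ℝ)..t, ‖v n s‖ := fun n t ht =>
    (hc _ _ _ (S.isClassicalSolution_state₂ (cφ n) (hvφ n)) (hv n) (hvc n) (hvs n) (z0 _)).2 t ht
  -- The difference `v n - v m` is again an admissible smooth input, so linearity of `output₂` turns
  -- stability into a Cauchy estimate.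
  have bound₂ : ∀ n m t, 0 < t →
      ∫ s in (0 : ℝ)..t, ‖S.output₂ (φ n) s - S.output₂ (φ m) s‖ ≤
        c * ∫ s in (0 : ℝ)..t, ‖v n s - v m s‖ := by
    intro n m t ht
    have e : EqOn (fun s => v n s - v m s)
        (primitive (primitive fun s => φ n s - φ m s)) (Ici 0) := fun s hs => by
      simp only [hvφ n hs, hvφ m hs]
      exact (primitive_sub_of_eq (locallyIntegrableOn_primitive (lφ n))
        (locallyIntegrableOn_primitive (lφ m))
        (fun r hr => primitive_sub (lφ n) (lφ m) hr) hs).symm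
    have hsub : tsupport (fun s => v n s - v m s) ⊆ Ioi 0 :=
      (tsupport_sub (v n) (v m)).trans (union_subset (hvs n) (hvs m))
    have h1 := (hc _ _ _ (S.isClassicalSolution_state₂ ((cφ n).sub (cφ m)) e)
      ((hv n).sub (hv m)) ((hvc n).sub (hvc m)) hsub (z0 _)).2 t ht
    refine (le_of_eq ?_).trans h1
    refine intervalIntegral.integral_congr fun s hs => ?_
    rw [uIcc_of_le ht.le] at hs
    simp only [← S.output₂_sub (lφ n) (lφ m) hs.1]
    rfl
  have hve' : ∀ k n : ℕ, k ≤ n → ∫ s in (0 : ℝ)..k, ‖u s - v n s‖ ≤ (1 / 2) ^ k := fun k n hkn =>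
    ((integral_norm_mono (lu.sub (lv n)) (Nat.cast_nonneg k) (Nat.cast_le.2 hkn)).trans
      (hve n)).trans (pow_le_pow_of_le_one (by norm_num) (by norm_num) hkn)
  obtain ⟨g, lg, hg⟩ := exists_tendsto_of_cauchy (c := c * 2) ly fun k n m hn hm => by
    rcases k.eq_zero_or_pos with rfl | hk
    · simp [hc0.le]
    have hk' : (0 : ℝ) < k := Nat.cast_pos.2 hk
    refine (bound₂ n m k hk').trans ?_
    rw [mul_assoc]
    refine mul_le_mul_of_nonneg_left ?_ hc0.le
    have h1 := integral_norm_le_add ((lv n).sub (lv m)) (lu.sub (lv m)) (lu.sub (lv n))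
      (fun s => by
        have := norm_sub_le (u s - v m s) (u s - v n s)
        simpa using this) hk'.le
    refine h1.trans ?_
    rw [two_mul]
    exact add_le_add (hve' k m hm) (hve' k n hn)
  have hvt : ∀ t, 0 ≤ t → Tendsto (fun n => ∫ s in (0 : ℝ)..t, ‖u s - v n s‖) atTop (𝓝 0) := by
    intro t ht
    refine squeeze_zero' (Eventually.of_forall fun n =>
      intervalIntegral.integral_nonneg ht fun _ _ => norm_nonneg _) ?_
      (tendsto_pow_atTop_nhds_zero_of_lt_one (r := (1 / 2 : ℝ)) (by norm_num) (by norm_num))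
    obtain ⟨k, hk⟩ := exists_nat_ge t
    filter_upwards [eventually_ge_atTop k] with n hn
    exact (integral_norm_mono (lu.sub (lv n)) ht (hk.trans (Nat.cast_le.2 hn))).trans (hve n)
  -- For each `t` the difference is at most `K ‖u - v n‖ + t ‖output₂ (φ n) - g‖` in `L¹` norms on
  -- `[0, t]`. The first term uses `output₂ (v n) = ∫∫ output₂ (φ n)`, and both terms tend to `0`.
  have hout : EqOn (primitive (primitive g)) (S.output₂ u) (Ici 0) := by
    intro t ht
    have ht : (0 : ℝ) ≤ t := ht
    obtain ⟨K, hK⟩ := S.exists_norm_output₂_le ht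
    have hlim := ((hvt t ht).const_mul K).add ((hg t ht).mul_const t)
    rw [mul_zero, zero_mul, zero_add] at hlim
    refine (eq_of_norm_sub_le_zero (ge_of_tendsto' hlim fun n => ?_)).symm
    have lp := locallyIntegrableOn_primitive (locallyIntegrableOn_primitive (lφ n))
    have h1 := hK _ (lu.sub lp)
    have h2 : S.output₂ (u - primitive (primitive (φ n))) t =
        S.output₂ u t - primitive (primitive (S.output₂ (φ n))) t := by
      rw [← S.output₂_primitive_primitive (lφ n) ht]
      exact S.output₂_sub lu lp ht
    have h3 : ∫ s in (0 : ℝ)..t, ‖(u - primitive (primitive (φ n))) s‖ =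
        ∫ s in (0 : ℝ)..t, ‖u s - v n s‖ := by
      refine intervalIntegral.integral_congr fun s hs => ?_
      rw [uIcc_of_le ht] at hs
      simp only [hvφ n hs.1]
      rfl
    rw [h2, h3] at h1
    have h4 := norm_primitive_le_of_le
      (fun s hs hst => norm_primitive_le_integral_norm ((ly n).sub lg) hs hst) ht le_rfl
    have h5 : primitive (primitive (S.output₂ (φ n) - g)) t =
        primitive (primitive (S.output₂ (φ n))) t - primitive (primitive g) t :=
      primitive_sub_of_eq (locallyIntegrableOn_primitive (ly n)) (locallyIntegrableOn_primitive lg)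
        (fun s hs => primitive_sub (ly n) lg hs) ht
    rw [h5] at h4
    rw [← sub_add_sub_cancel _ (primitive (primitive (S.output₂ (φ n))) t)]
    exact (norm_add_le _ _).trans (add_le_add h1 h4)
  refine ⟨g, lg, ?_, fun t ht => ?_⟩
  · rw [S.output₂_of_isGeneralisedSolution hs,
      ← distOf_congr (locallyIntegrableOn_primitive (locallyIntegrableOn_primitive lg)) hout,
      lineDeriv_distOf_primitive (locallyIntegrableOn_primitive lg), lineDeriv_distOf_primitive lg]
  -- In `L¹` norms on `[0, t]`, `‖g‖ ≤ ‖output₂ (φ n) - g‖ + c (‖u‖ + ‖u - v n‖)`; the limit keeps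
  -- the same constant `c`.
  · have hlim := (hg t ht.le).add (((hvt t ht.le).const_add (∫ s in (0 : ℝ)..t, ‖u s‖)).const_mul c)
    rw [zero_add, add_zero] at hlim
    refine ge_of_tendsto' hlim fun n => ?_
    have h1 := integral_norm_le_add lg ((ly n).sub lg) (ly n) (fun s => by
      have := norm_sub_le (S.output₂ (φ n) s) (S.output₂ (φ n) s - g s)
      rw [sub_sub_cancel] at this
      rw [add_comm]
      exact this) ht.le
    have h2 := integral_norm_le_add (lv n) lu (lu.sub (lv n)) (fun s => by
      have := norm_sub_le (u s) (u s - v n s)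
      rwa [sub_sub_cancel] at this) ht.le
    exact h1.trans (add_le_add le_rfl
      ((bound n t ht).trans (mul_le_mul_of_nonneg_left h2 hc0.le)))

end SystemNode

theorem mainTheorem6 {U X Y : Type*}
    [NormedAddCommGroup U] [NormedSpace ℂ U] [CompleteSpace U]
    [NormedAddCommGroup X] [NormedSpace ℂ X] [CompleteSpace X]
    [NormedAddCommGroup Y] [NormedSpace ℂ Y] [CompleteSpace Y]
    (S : SystemNode U X Y) :
    S.IsSmoothLILOStable ↔ S.IsL1LILOStable :=
  ⟨fun h => h.isL1LILOStable, fun h => h.isSmoothLILOStable⟩
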